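/- Theorem 6.1. Let $d\ge 1$ and let $\Omega\subset\mathbb{R}^d$ be a bounded open set. Let $H^1_0(\Omega)$ be the closure of $C_c^\infty(\Omega)$ in $H^1(\Omega)$, and let $H^{-1}(\Omega)$ be its dual space, normed by $\|F\|_{-1}^2=\langle F,(-\Delta)^{-1}F\rangle$, where $w=(-\Delta)^{-1}F\in H^1_0(\Omega)$ is the solution of the Dirichlet problem $\int_\Omega\nabla w\cdot\nabla\varphi\,dx=\langle F,\varphi\rangle$ for all $\varphi\in H^1_0(\Omega)$. Let $f\in H^{-1}(\Omega)$ and let $j:\mathbb{R}\to\mathbb{R}$ be convex and lower semicontinuous with $j(0)=0$ and $$\lim_{|r|\to\infty}\frac{j(r)}{|r|}=+\infty .$$ Let $\beta(r)=\{\omega\in\mathbb{R}:\ \omega(r-s)\ge j(r)-j(s)\ \text{for all } s\in\mathbb{R}\}$ be the subdifferential of $j$. Then the minimization problem $$\min\Big\{\int_\Omega j(u(x))\,dx+\tfrac12\|u-f\|_{-1}^2:\ u\in L^1(\Omega),\ u-f\in H^{-1}(\Omega)\Big\}$$ has a unique solution $u^*$. (Here $u-f\in H^{-1}(\Omega)$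 means that the distribution $\varphi\mapsto\int_\Omega u\varphi\,dx-\langle f,\varphi\rangle$ on $C_c^\infty(\Omega)$ extends to an element of $H^{-1}(\Omega)$, denoted again by $u-f$; and $\int_\Omega j(u)\,dx=+\infty$ if $j(u)\notin L^1(\Omega)$.) Moreover there is $\eta^*\in H^1_0(\Omega)$ such that $\eta^*(x)\in\beta(u^*(x))$ for a.e. $x\in\Omega$ and $$\int_\Omega\nabla\eta^*\cdot\nabla\varphi\,dx+\langle u^*-f,\varphi\rangle=0\qquad\text{for all }\varphi\in H^1_0(\Omega).$$ -/

import Mathlib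

open MeasureTheory Set Filter Topology TopologicalSpace
open scoped Distributions RealInnerProductSpace Gradient

noncomputable section

namespace ImageRestoration

/-- The Euclidean space `ℝ^d`. -/
abbrev Rd (d : ℕ) := EuclideanSpace ℝ (Fin d)

variable {d : ℕ}

/-- Lebesgue measure on the open set `Ω`. -/
abbrev vol (Ω : Opens (Rd d)) : Measure (Rd d) := volume.restrict (Ω : Set (Rd d))

/-- The real Hilbert space `L²(Ω) × L²(Ω; ℝ^d)`, with inner product
`∫_Ω u v + ∫_Ω G ⬝ H`; its elements serve as pairs (function, gradient). -/
abbrev L2Pair (Ω : Opens (Rd d)) :=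
  WithLp 2 (Lp ℝ 2 (vol Ω) × Lp (Rd d) 2 (vol Ω))

/-! ### Sobolev spaces -/

/-- `G` is the gradient of `u` in the sense of distributions on `Ω`:
`∫_Ω u ∂_i φ = - ∫_Ω G_i φ` for all test functions `φ ∈ C_c^∞(Ω)` and all `i`. -/
def HasWeakGradient (Ω : Opens (Rd d)) (u : Rd d → ℝ) (G : Rd d → Rd d) : Prop :=
  ∀ (φ : 𝓓(Ω, ℝ)) (i : Fin d),
    ∫ x in (Ω : Set (Rd d)), u x * fderiv ℝ φ x (EuclideanSpace.single i 1)
      = - ∫ x in (Ω : Set (Rd d)), G x i * φ x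

/-- The Sobolev space `H¹(Ω)`, each function being listed with its weak gradient. -/
def H1 (Ω : Opens (Rd d)) : Set (L2Pair Ω) := {w | HasWeakGradient Ω w.fst w.snd}

theorem memLp_test (Ω : Opens (Rd d)) (φ : 𝓓(Ω, ℝ)) : MemLp φ 2 (vol Ω) :=
  φ.continuous.memLp_of_hasCompactSupport φ.hasCompactSupport

theorem continuous_grad_test (Ω : Opens (Rd d)) (φ : 𝓓(Ω, ℝ)) : Continuous (∇ (φ : Rd d → ℝ)) :=
  (InnerProductSpace.toDual ℝ (Rd d)).symm.continuous.comp
    (φ.contDiff.continuous_fderiv (by simp))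

theorem hasCompactSupport_grad_test (Ω : Opens (Rd d)) (φ : 𝓓(Ω, ℝ)) :
    HasCompactSupport (∇ (φ : Rd d → ℝ)) :=
  (φ.hasCompactSupport.fderiv (𝕜 := ℝ)).comp_left
    (g := (InnerProductSpace.toDual ℝ (Rd d)).symm) (map_zero _)

theorem memLp_grad_test (Ω : Opens (Rd d)) (φ : 𝓓(Ω, ℝ)) :
    MemLp (∇ (φ : Rd d → ℝ)) 2 (vol Ω) :=
  (continuous_grad_test Ω φ).memLp_of_hasCompactSupport
    (hasCompactSupport_grad_test Ω φ)

/-- The pair `(φ, ∇φ)` of a test function `φ ∈ C_c^∞(Ω)`. -/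
def testPair (Ω : Opens (Rd d)) : 𝓓(Ω, ℝ) →ₗ[ℝ] L2Pair Ω where
  toFun φ := WithLp.toLp 2 ((memLp_test Ω φ).toLp φ, (memLp_grad_test Ω φ).toLp (∇ (φ : Rd d → ℝ)))
  map_add' φ ψ := by
    have h : ∇ (⇑(φ + ψ) : Rd d → ℝ) = ∇ (φ : Rd d → ℝ) + ∇ (ψ : Rd d → ℝ) := by
      funext x
      have h1 : DifferentiableAt ℝ φ x := φ.contDiff.differentiable (by simp) x
      have h2 : DifferentiableAt ℝ ψ x := ψ.contDiff.differentiable (by simp) x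
      simp only [gradient, FunLike.coe_add, Pi.add_apply]
      rw [fderiv_add h1 h2, map_add]
    apply (WithLp.equiv 2 _).injective
    refine Prod.ext ?_ ?_
    · exact MemLp.toLp_add (memLp_test Ω φ) (memLp_test Ω ψ)
    · refine Eq.trans ?_ (MemLp.toLp_add (memLp_grad_test Ω φ) (memLp_grad_test Ω ψ))
      exact MemLp.toLp_congr (memLp_grad_test Ω (φ + ψ)) _ (Eventually.of_forall (congrFun h))
  map_smul' c φ := by
    have h : ∇ (⇑(c • φ) : Rd d → ℝ) = c • ∇ (φ : Rd d → ℝ) := by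
      funext x
      have h1 : DifferentiableAt ℝ φ x := φ.contDiff.differentiable (by simp) x
      simp only [gradient, FunLike.coe_smul, Pi.smul_apply]
      rw [fderiv_const_smul h1, map_smul]
    apply (WithLp.equiv 2 _).injective
    refine Prod.ext ?_ ?_
    · exact MemLp.toLp_const_smul c (memLp_test Ω φ)
    · refine Eq.trans ?_ (MemLp.toLp_const_smul c (memLp_grad_test Ω φ))
      exact MemLp.toLp_congr (memLp_grad_test Ω (c • φ)) _ (Eventually.of_forall (congrFun h))

/-- The Sobolev space `H¹₀(Ω)`: the closure of the test functions in the `H¹` norm. -/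
def H10 (Ω : Opens (Rd d)) : Submodule ℝ (L2Pair Ω) :=
  (LinearMap.range (testPair Ω)).topologicalClosure

namespace H10

variable {Ω : Opens (Rd d)}

/-- The function underlying an element of `H¹₀(Ω)`. -/
def fn (w : H10 Ω) : Lp ℝ 2 (vol Ω) := (w : L2Pair Ω).fst

/-- The (weak) gradient of an element of `H¹₀(Ω)`. -/
def grad (w : H10 Ω) : Lp (Rd d) 2 (vol Ω) := (w : L2Pair Ω).snd

/-- A test function as an element of `H¹₀(Ω)`. -/
def ofTest (φ : 𝓓(Ω, ℝ)) : H10 Ω :=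
  ⟨testPair Ω φ, Submodule.le_topologicalClosure _ (LinearMap.mem_range_self _ φ)⟩

theorem exists_seq_test (w : H10 Ω) :
    ∃ φ : ℕ → 𝓓(Ω, ℝ), Tendsto (fun n => ofTest (φ n)) atTop (𝓝 w) := by
  have hw : (w : L2Pair Ω) ∈ closure (LinearMap.range (testPair Ω) : Set (L2Pair Ω)) := by
    exact w.2
  obtain ⟨x, hx, hlim⟩ := mem_closure_iff_seq_limit.1 hw
  choose φ hφ using hx
  refine ⟨φ, tendsto_subtype_rng.2 ?_⟩
  refine hlim.congr fun n => ?_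
  exact (hφ n).symm

theorem induction_closed {p : H10 Ω → Prop} (hp : IsClosed {w | p w})
    (h : ∀ φ : 𝓓(Ω, ℝ), p (ofTest φ)) (w : H10 Ω) : p w := by
  obtain ⟨φ, hφ⟩ := exists_seq_test w
  exact hp.mem_of_tendsto hφ (Eventually.of_forall fun n => h (φ n))

theorem fn_ofTest (φ : 𝓓(Ω, ℝ)) : fn (ofTest φ) =ᵐ[vol Ω] φ :=
  MemLp.coeFn_toLp (memLp_test Ω φ)

theorem grad_ofTest (φ : 𝓓(Ω, ℝ)) : grad (ofTest φ) =ᵐ[vol Ω] ∇ (φ : Rd d → ℝ) :=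
  MemLp.coeFn_toLp (memLp_grad_test Ω φ)

end H10

/-- The space `H¹₀(Ω)` consists of elements of `H¹(Ω)`. -/
theorem H10_subset_H1 (Ω : Opens (Rd d)) : (H10 Ω : Set (L2Pair Ω)) ⊆ H1 Ω := by
  intro w hw φ i
  have hD : Continuous fun x => fderiv ℝ φ x (EuclideanSpace.single i 1) :=
    (φ.contDiff.continuous_fderiv (by simp)).clm_apply continuous_const
  have hDs : HasCompactSupport fun x => fderiv ℝ φ x (EuclideanSpace.single i 1) :=
    (φ.hasCompactSupport.fderiv (𝕜 := ℝ)).comp_left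
      (g := fun L : Rd d →L[ℝ] ℝ => L (EuclideanSpace.single i 1)) rfl
  have hDm : MemLp (fun x => fderiv ℝ φ x (EuclideanSpace.single i 1)) 2 (vol Ω) :=
    hD.memLp_of_hasCompactSupport hDs
  have hVm : MemLp (fun x => φ x • (EuclideanSpace.single i 1 : Rd d)) 2 (vol Ω) :=
    (φ.continuous.smul continuous_const).memLp_of_hasCompactSupport
      (φ.hasCompactSupport.smul_right)
  have e1 (v : L2Pair Ω) :
      ∫ x in (Ω : Set (Rd d)), v.fst x * fderiv ℝ φ x (EuclideanSpace.single i 1)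
        = ⟪hDm.toLp _, v.fst⟫ := by
    rw [L2.inner_def]
    refine integral_congr_ae ?_
    filter_upwards [hDm.coeFn_toLp] with x hx
    rw [hx]
    simp
  have e2 (v : L2Pair Ω) :
      ∫ x in (Ω : Set (Rd d)), v.snd x i * φ x = ⟪hVm.toLp _, v.snd⟫ := by
    rw [L2.inner_def]
    refine integral_congr_ae ?_
    filter_upwards [hVm.coeFn_toLp] with x hx
    rw [hx, real_inner_smul_left, EuclideanSpace.inner_single_left]
    simp [mul_comm]
  refine H10.induction_closed (Ω := Ω) (p := fun v =>
    ∫ x in (Ω : Set (Rd d)), (v : L2Pair Ω).fst x * fderiv ℝ φ x (EuclideanSpace.single i 1)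
      = - ∫ x in (Ω : Set (Rd d)), (v : L2Pair Ω).snd x i * φ x) ?_ ?_ ⟨w, hw⟩
  · simp_rw [e1, e2]
    have c1 : Continuous fun v : H10 Ω => (v : L2Pair Ω).fst :=
      (WithLp.fstL 2 ℝ _ _).continuous.comp continuous_subtype_val
    have c2 : Continuous fun v : H10 Ω => (v : L2Pair Ω).snd :=
      (WithLp.sndL 2 ℝ _ _).continuous.comp continuous_subtype_val
    exact isClosed_eq (continuous_const.inner c1) (continuous_const.inner c2).neg
  · intro ψ
    have h1 : ∫ x in (Ω : Set (Rd d)),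
        (H10.ofTest ψ : L2Pair Ω).fst x * fderiv ℝ φ x (EuclideanSpace.single i 1)
        = ∫ x : Rd d, ψ x * fderiv ℝ φ x (EuclideanSpace.single i 1) := by
      rw [← setIntegral_eq_integral_of_forall_compl_eq_zero (s := (Ω : Set (Rd d))) (f := fun x => ψ x * fderiv ℝ φ x (EuclideanSpace.single i 1))]
      · refine integral_congr_ae ?_
        filter_upwards [H10.fn_ofTest ψ] with x hx
        exact congrArg (· * _) hx
      · intro x hx
        rw [image_eq_zero_of_notMem_tsupport fun h => hx (ψ.tsupport_subset h), zero_mul]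
    have h2 : ∫ x in (Ω : Set (Rd d)), (H10.ofTest ψ : L2Pair Ω).snd x i * φ x
        = ∫ x : Rd d, fderiv ℝ ψ x (EuclideanSpace.single i 1) * φ x := by
      rw [← setIntegral_eq_integral_of_forall_compl_eq_zero (s := (Ω : Set (Rd d))) (f := fun x => fderiv ℝ ψ x (EuclideanSpace.single i 1) * φ x)]
      · refine integral_congr_ae ?_
        filter_upwards [H10.grad_ofTest ψ] with x hx
        have hx' : (H10.ofTest ψ : L2Pair Ω).snd x = ∇ (ψ : Rd d → ℝ) x := hx
        rw [hx', ← inner_gradient_left, EuclideanSpace.inner_single_right]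
        simp
      · intro x hx
        rw [image_eq_zero_of_notMem_tsupport fun h => hx (φ.tsupport_subset h), mul_zero]
    have hDψ : Continuous fun x => fderiv ℝ ψ x (EuclideanSpace.single i 1) :=
      (ψ.contDiff.continuous_fderiv (by simp)).clm_apply continuous_const
    rw [h1, h2]
    refine integral_mul_fderiv_eq_neg_fderiv_mul_of_integrable ?_ ?_ ?_ ?_ ?_
    · exact (hDψ.mul φ.continuous).integrable_of_hasCompactSupport
        φ.hasCompactSupport.mul_left
    · exact (ψ.continuous.mul hD).integrable_of_hasCompactSupport
        ψ.hasCompactSupport.mul_right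
    · exact (ψ.continuous.mul φ.continuous).integrable_of_hasCompactSupport
        φ.hasCompactSupport.mul_left
    · exact fun x _ => ψ.contDiff.differentiable (by simp) x
    · exact fun x _ => φ.contDiff.differentiable (by simp) x

/-- The Dirichlet form `∫_Ω ∇w ⬝ ∇φ`. -/
def dirichlet {Ω : Opens (Rd d)} (w φ : H10 Ω) : ℝ :=
  ∫ x in (Ω : Set (Rd d)), ⟪H10.grad w x, H10.grad φ x⟫

/-! ### The space `H⁻¹(Ω)` -/

/-- `H⁻¹(Ω)`, the dual space of `H¹₀(Ω)`. -/
abbrev Hm1 (Ω : Opens (Rd d)) := StrongDual ℝ (H10 Ω)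

/-- `w ∈ H¹₀(Ω)` solves the Dirichlet problem `-Δw = F` in `Ω`, `w = 0` on `∂Ω`. -/
def IsDirichletSolution {Ω : Opens (Rd d)} (F : Hm1 Ω) (w : H10 Ω) : Prop :=
  ∀ φ : H10 Ω, dirichlet w φ = F φ

/-- Poincaré's inequality. -/
theorem poincare [NeZero d] {Ω : Opens (Rd d)} (hΩ : Bornology.IsBounded (Ω : Set (Rd d))) :
    ∃ C : ℝ, ∀ w : H10 Ω, ‖H10.fn w‖ ^ 2 ≤ C * ‖H10.grad w‖ ^ 2 := by
  obtain ⟨R, hR⟩ := hΩ.exists_norm_le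
  refine ⟨4 * R ^ 2, fun w => ?_⟩
  refine H10.induction_closed (p := fun w => ‖H10.fn w‖ ^ 2 ≤ 4 * R ^ 2 * ‖H10.grad w‖ ^ 2) ?_ ?_ w
  · have c1 : Continuous fun v : H10 Ω => H10.fn v :=
      (WithLp.fstL 2 ℝ _ _).continuous.comp continuous_subtype_val
    have c2 : Continuous fun v : H10 Ω => H10.grad v :=
      (WithLp.sndL 2 ℝ _ _).continuous.comp continuous_subtype_val
    exact isClosed_le (c1.norm.pow 2) (continuous_const.mul (c2.norm.pow 2))
  · intro φ
    have e1 : ‖H10.fn (H10.ofTest φ)‖ ^ 2 = ∫ x, φ x * φ x := by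
      rw [← real_inner_self_eq_norm_sq, L2.inner_def,
        ← setIntegral_eq_integral_of_forall_compl_eq_zero (s := (Ω : Set (Rd d))) (f := fun x => φ x * φ x)]
      · refine integral_congr_ae ?_
        filter_upwards [H10.fn_ofTest φ] with x hx
        rw [hx, real_inner_self_eq_norm_sq, Real.norm_eq_abs, sq_abs, sq]
      · intro x hx
        rw [image_eq_zero_of_notMem_tsupport fun h => hx (φ.tsupport_subset h), zero_mul]
    have hG0 : ∀ x, x ∉ (Ω : Set (Rd d)) → ∇ (φ : Rd d → ℝ) x = 0 := by
      intro x hx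
      have : fderiv ℝ φ x = 0 := by
        refine image_eq_zero_of_notMem_tsupport fun h => hx (φ.tsupport_subset ?_)
        exact tsupport_fderiv_subset ℝ h
      simp [gradient, this]
    have e2 : ‖H10.grad (H10.ofTest φ)‖ ^ 2 = ∫ x, ‖∇ (φ : Rd d → ℝ) x‖ ^ 2 := by
      rw [← real_inner_self_eq_norm_sq, L2.inner_def,
        ← setIntegral_eq_integral_of_forall_compl_eq_zero (s := (Ω : Set (Rd d))) (f := fun x => ‖∇ (φ : Rd d → ℝ) x‖ ^ 2)]
      · refine integral_congr_ae ?_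
        filter_upwards [H10.grad_ofTest φ] with x hx
        rw [hx, real_inner_self_eq_norm_sq]
      · intro x hx
        rw [hG0 x hx]
        simp
    set e : Rd d := EuclideanSpace.single 0 1 with he
    have hφs := φ.hasCompactSupport
    have hφd : Differentiable ℝ φ := φ.contDiff.differentiable (by simp)
    have hD : Continuous fun x => fderiv ℝ φ x e :=
      (φ.contDiff.continuous_fderiv (by simp)).clm_apply continuous_const
    have hx0 : Continuous fun x : Rd d => x 0 := by fun_prop
    have hder : ∀ x : Rd d, fderiv ℝ (fun y : Rd d => y 0) x e = 1 := by
      intro x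
      have : (fun y : Rd d => y 0) = (EuclideanSpace.proj (0 : Fin d) : Rd d →L[ℝ] ℝ) := by
        ext y; simp
      rw [this, ContinuousLinearMap.fderiv]
      simp [he]
    have hder2 : ∀ x : Rd d, fderiv ℝ (fun y : Rd d => φ y * φ y) x e
        = 2 * (φ x * fderiv ℝ φ x e) := by
      intro x
      rw [fderiv_fun_mul (hφd x) (hφd x)]
      simp
      ring
    have ibp : ∫ x : Rd d, x 0 * fderiv ℝ (fun y : Rd d => φ y * φ y) x e
        = - ∫ x : Rd d, fderiv ℝ (fun y : Rd d => y 0) x e * (φ x * φ x) := by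
      refine integral_mul_fderiv_eq_neg_fderiv_mul_of_integrable ?_ ?_ ?_ ?_ ?_
      · simp_rw [hder, one_mul]
        exact (φ.continuous.mul φ.continuous).integrable_of_hasCompactSupport hφs.mul_left
      · simp_rw [hder2]
        refine (hx0.mul (continuous_const.mul
          (φ.continuous.mul hD))).integrable_of_hasCompactSupport ?_
        exact (HasCompactSupport.mul_left (HasCompactSupport.mul_right hφs)).mul_left
      · exact (hx0.mul (φ.continuous.mul φ.continuous)).integrable_of_hasCompactSupport
          (HasCompactSupport.mul_left hφs.mul_left)
      · exact fun x _ => by fun_prop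
      · exact fun x _ => (hφd x).mul (hφd x)
    simp_rw [hder, hder2, one_mul] at ibp
    have i1 : Integrable fun x : Rd d => φ x * φ x :=
      (φ.continuous.mul φ.continuous).integrable_of_hasCompactSupport hφs.mul_left
    have i2 : Integrable fun x : Rd d => x 0 * (2 * (φ x * fderiv ℝ φ x e)) :=
      (hx0.mul (continuous_const.mul
          (φ.continuous.mul hD))).integrable_of_hasCompactSupport
        (HasCompactSupport.mul_left (HasCompactSupport.mul_right hφs)).mul_left
    have i3 : Integrable fun x : Rd d => ‖∇ (φ : Rd d → ℝ) x‖ ^ 2 :=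
      ((continuous_grad_test Ω φ).memLp_of_hasCompactSupport (p := 2)
        (hasCompactSupport_grad_test Ω φ)).integrable_norm_pow (by simp)
    have key : ∫ x : Rd d, -(x 0 * (2 * (φ x * fderiv ℝ φ x e)))
        ≤ ∫ x : Rd d, (1 / 2 * (φ x * φ x) + 2 * R ^ 2 * ‖∇ (φ : Rd d → ℝ) x‖ ^ 2) := by
      refine integral_mono i2.neg ((i1.const_mul _).add (i3.const_mul _)) fun x => ?_
      by_cases hx : x ∈ (Ω : Set (Rd d))
      · have hb : |x 0| ≤ R := by
          have := (PiLp.norm_apply_le x 0).trans (hR x hx)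
          simpa using this
        have hg : |fderiv ℝ φ x e| ≤ ‖∇ (φ : Rd d → ℝ) x‖ := by
          rw [← inner_gradient_left]
          refine (abs_real_inner_le_norm _ _).trans ?_
          simp [he]
        have h3 : |x 0| * |fderiv ℝ φ x e| ≤ R * ‖∇ (φ : Rd d → ℝ) x‖ :=
          mul_le_mul hb hg (abs_nonneg _) ((abs_nonneg _).trans hb)
        have h4 : (x 0 * fderiv ℝ φ x e) ^ 2 ≤ (R * ‖∇ (φ : Rd d → ℝ) x‖) ^ 2 := by
          rw [← sq_abs, abs_mul]
          exact pow_le_pow_left₀ (by positivity) h3 2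
        show -(x 0 * (2 * (φ x * fderiv ℝ φ x e)))
          ≤ 1 / 2 * (φ x * φ x) + 2 * R ^ 2 * ‖∇ (φ : Rd d → ℝ) x‖ ^ 2
        nlinarith [sq_nonneg (φ x + 2 * (x 0 * fderiv ℝ φ x e))]
      · have h0 : φ x = 0 :=
          image_eq_zero_of_notMem_tsupport fun h => hx (φ.tsupport_subset h)
        show -(x 0 * (2 * (φ x * fderiv ℝ φ x e)))
          ≤ 1 / 2 * (φ x * φ x) + 2 * R ^ 2 * ‖∇ (φ : Rd d → ℝ) x‖ ^ 2
        rw [h0]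
        simp
        positivity
    rw [integral_neg, ibp, integral_add (i1.const_mul _) (i3.const_mul _),
      integral_const_mul, integral_const_mul] at key
    rw [e1, e2]
    linarith

/-- On a bounded open set the Dirichlet problem is uniquely solvable. -/
theorem existsUnique_isDirichletSolution [NeZero d] {Ω : Opens (Rd d)}
    (hΩ : Bornology.IsBounded (Ω : Set (Rd d))) (F : Hm1 Ω) :
    ∃! w, IsDirichletSolution F w := by
  obtain ⟨C, hC⟩ := poincare hΩ
  let G : H10 Ω →L[ℝ] Lp (Rd d) 2 (vol Ω) := (WithLp.sndL 2 ℝ _ _).comp (H10 Ω).subtypeL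
  let B : H10 Ω →L[ℝ] H10 Ω →L[ℝ] ℝ := (innerSL ℝ).bilinearComp G G
  have hB : ∀ w φ, B w φ = dirichlet w φ := fun _ _ => rfl
  have hnorm : ∀ w : H10 Ω, ‖w‖ ^ 2 = ‖H10.fn w‖ ^ 2 + ‖H10.grad w‖ ^ 2 := fun w =>
    WithLp.prod_norm_sq_eq_of_L2 (w : L2Pair Ω)
  have hself : ∀ w : H10 Ω, B w w = ‖H10.grad w‖ ^ 2 := fun w => real_inner_self_eq_norm_sq (H10.grad w)
  have hcoer : IsCoercive B := by
    refine ⟨(|C| + 1)⁻¹, by positivity, fun w => ?_⟩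
    rw [hself, mul_assoc, ← sq, hnorm, inv_mul_le_iff₀ (by positivity)]
    nlinarith [hC w, le_abs_self C, sq_nonneg ‖H10.grad w‖]
  have : CompleteSpace (H10 Ω) :=
    (Submodule.isClosed_topologicalClosure _).completeSpace_coe
  refine ⟨hcoer.continuousLinearEquivOfBilin.symm ((InnerProductSpace.toDual ℝ _).symm F), ?_, ?_⟩
  · intro φ
    rw [← hB, ← hcoer.continuousLinearEquivOfBilin_apply]
    simp
  · intro w hw
    rw [ContinuousLinearEquiv.eq_symm_apply]
    symm
    refine hcoer.unique_continuousLinearEquivOfBilin fun φ => ?_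
    rw [InnerProductSpace.toDual_symm_apply, hB, hw φ]

/-- `(-Δ)⁻¹ F`, the solution of the Dirichlet problem with right-hand side `F`
(it exists and is unique when `Ω` is bounded). -/
def invNegLaplacian {Ω : Opens (Rd d)} (F : Hm1 Ω) : H10 Ω :=
  Classical.epsilon (IsDirichletSolution F)

/-- The square of the norm of `H⁻¹(Ω)`: `‖F‖²₋₁ = ⟨F, (-Δ)⁻¹ F⟩`. -/
def normSqHm1 {Ω : Opens (Rd d)} (F : Hm1 Ω) : ℝ := F (invNegLaplacian F)

/-- For `u ∈ L¹(Ω)` and `f, F ∈ H⁻¹(Ω)`: `u - f = F` as distributions on `Ω`. -/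
def IsDiff {Ω : Opens (Rd d)} (u : Lp ℝ 1 (vol Ω)) (f F : Hm1 Ω) : Prop :=
  ∀ φ : 𝓓(Ω, ℝ),
    (∫ x in (Ω : Set (Rd d)), u x * φ x) - f (H10.ofTest φ) = F (H10.ofTest φ)

/-- There is at most one element of `H⁻¹(Ω)` which equals the distribution `u - f`. -/
theorem IsDiff.unique {Ω : Opens (Rd d)} {u : Lp ℝ 1 (vol Ω)} {f F F' : Hm1 Ω}
    (h : IsDiff u f F) (h' : IsDiff u f F') : F = F' := by
  ext w
  refine H10.induction_closed (p := fun w => F w = F' w)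
    (isClosed_eq F.continuous F'.continuous) (fun φ => ?_) w
  exact (h φ).symm.trans (h' φ)

/-- The set of competitors: `u ∈ L¹(Ω)` with `u - f ∈ H⁻¹(Ω)`. -/
def admissible {Ω : Opens (Rd d)} (f : Hm1 Ω) : Set (Lp ℝ 1 (vol Ω)) :=
  {u | ∃ F : Hm1 Ω, IsDiff u f F}

/-- The element `u - f` of `H⁻¹(Ω)`, for admissible `u`. -/
def subHm1 {Ω : Opens (Rd d)} (u : Lp ℝ 1 (vol Ω)) (f : Hm1 Ω) : Hm1 Ω :=
  Classical.epsilon (IsDiff u f)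

theorem isDiff_subHm1 {Ω : Opens (Rd d)} {u : Lp ℝ 1 (vol Ω)} {f : Hm1 Ω}
    (hu : u ∈ admissible f) : IsDiff u f (subHm1 u f) :=
  Classical.epsilon_spec hu

/-! ### The variational problem -/

open scoped Classical in
/-- The functional `∫_Ω j(u) dx + ½ ‖u - f‖²₋₁` on admissible `u`, with values in `(-∞, +∞]`.
As `Ω` is bounded and `j` is bounded below, `∫_Ω j(u) dx = +∞` when `j(u)` is not integrable. -/
def energy {Ω : Opens (Rd d)} (j : ℝ → ℝ) (f : Hm1 Ω) (u : Lp ℝ 1 (vol Ω)) : EReal :=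
  if Integrable (fun x => j (u x)) (vol Ω) then
    (((∫ x in (Ω : Set (Rd d)), j (u x)) + 1 / 2 * normSqHm1 (subHm1 u f) : ℝ) : EReal)
  else (⊤ : EReal)

/-- `u` solves `Min {∫_Ω j(u) dx + ½ ‖u - f‖²₋₁ : u ∈ L¹(Ω), u - f ∈ H⁻¹(Ω)}`. -/
def IsSolution {Ω : Opens (Rd d)} (j : ℝ → ℝ) (f : Hm1 Ω) (u : Lp ℝ 1 (vol Ω)) : Prop :=
  u ∈ admissible f ∧ IsMinOn (energy j f) (admissible f) u

/-- The subdifferential `β(r)` of `j : ℝ → ℝ` at `r`. -/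
def subdifferential (j : ℝ → ℝ) (r : ℝ) : Set ℝ :=
  {ω | ∀ s : ℝ, j r - j s ≤ ω * (r - s)}

end ImageRestoration

end

open ImageRestoration

open ImageRestoration

/-! Write `u - f = -Δw` with `w ∈ H¹₀`, so that `‖u - f‖²₋₁ = ‖∇w‖²`. The Euler-Lagrange system then
asks for a pair `(u, w)` with `-w ∈ β(u)` almost everywhere, and `η = -w` is the required function.
The proof constructs such a pair by approximation and then shows that it gives the only minimiser.

Existence. `∫ j(u) + δ/2 ‖u‖² + ½ ‖u - f‖²₋₁` is minimised over the `L²` functions bounded by `n`,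
where `j` is bounded and the functional is uniformly convex. With `δ = 1/(n+1)` the minimal energies
decrease in `n`, and convexity of the quadratic term turns their convergence into strong convergence
of `w n` in `H¹₀` (`norm_sq_sub_le_of_minimizer`). Local variations give a subgradient inequality
for each constant `|s| ≤ n`. The bound on `∫ j(u n)` and superlinearity make `u n` uniformly
integrable, hence weakly convergent in `L¹` (`exists_weak_L1_limit`). The inequality survives the
limit because `j` is a supremum of affine functions and `w n` converges almost uniformly by Egorov
(`subgradient_of_weak_limit`).

Minimality and uniqueness. For a competitor `v` with `v - f = -Δz`, the subgradient inequality
bounds the difference of the `j`-integrals by `∫ (v - u) w`, which should equal `∫ ∇(z - w) ⬝ ∇w`.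
The product of an `L¹` function and an `H¹₀` function need not be integrable; by a Brezis-Browder
argument a one-sided integrable bound suffices (`integrable_mul_fn`), and the subgradient inequality
supplies it. The energy gap is then at least `½ ‖∇(z - w)‖²` (`energy_gap`), so a second minimiser
has the same `u - f` and is the same function. Strict convexity of `j` plays no part. -/

/-! ### Superlinear convex functions on the line -/

/-- A superlinear lower semicontinuous function on the line is bounded below. -/
theorem exists_neg_le_of_superlinear {j : ℝ → ℝ} (hj : Continuous j)
    (hsuper : Tendsto (fun r : ℝ => j r / |r|) (cocompact ℝ) atTop) :
    ∃ C : ℝ, 0 ≤ C ∧ ∀ r, -C ≤ j r := by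
  obtain ⟨K, hK, hKs⟩ := mem_cocompact.1 (hsuper.eventually (eventually_ge_atTop 0))
  -- The quotient `j 0 / |0|` is `0` by convention and says nothing about `j 0`, so the point `0` is
  -- moved to the compact part.
  obtain ⟨B, hB⟩ := (hK.insert 0).exists_bound_of_continuousOn hj.continuousOn
  refine ⟨|B|, abs_nonneg _, fun r => ?_⟩
  by_cases hr : r ∈ insert 0 K
  · have := hB r hr
    rw [Real.norm_eq_abs] at this
    linarith [neg_abs_le (j r), le_abs_self B]
  · rw [mem_insert_iff, not_or] at hr
    have h1 : 0 ≤ j r / |r| := hKs hr.2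
    have : 0 ≤ j r := (div_nonneg_iff.1 h1).elim (fun h => h.1)
      (fun h => absurd h.2 (not_le.2 (abs_pos.2 hr.1)))
    linarith [abs_nonneg B]

/-- Quantitative form of superlinear growth. -/
theorem exists_abs_le_mul_of_superlinear {j : ℝ → ℝ}
    (hsuper : Tendsto (fun r : ℝ => j r / |r|) (cocompact ℝ) atTop) {C : ℝ} (hC : 0 ≤ C)
    {ε : ℝ} (hε : 0 < ε) :
    ∃ M : ℝ, 0 < M ∧ ∀ r, M ≤ |r| → |r| ≤ ε * (j r + C) := by
  obtain ⟨K, hK, hKs⟩ := mem_cocompact.1 (hsuper.eventually (eventually_ge_atTop ε⁻¹))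
  obtain ⟨B, hB⟩ := hK.isBounded.exists_norm_le
  refine ⟨|B| + 1, by positivity, fun r hr => ?_⟩
  have hrK : r ∉ K := fun h => by
    have := hB r h
    rw [Real.norm_eq_abs] at this
    linarith [le_abs_self B]
  have h1 : ε⁻¹ ≤ j r / |r| := hKs hrK
  have hr0 : 0 < |r| := by linarith [abs_nonneg B]
  rw [le_div_iff₀ hr0, inv_mul_le_iff₀ hε] at h1
  nlinarith

/-- A finite convex function on the line is the supremum of countably many affine functions. -/
theorem exists_countable_affine {j : ℝ → ℝ} (hconv : ConvexOn ℝ univ j)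
    (hlsc : LowerSemicontinuous j) :
    ∃ p c : ℕ → ℝ, (∀ i r, p i * r + c i ≤ j r) ∧
      ∀ r b, (∀ i, p i * r + c i ≤ b) → j r ≤ b := by
  obtain ⟨l, c, h1, h2⟩ := ConvexOn.real_univ_sSup_of_nat_affine_eq hlsc hconv
  have hl : ∀ i r, l i r = l i 1 * r := fun i r => by
    conv_lhs => rw [← mul_one r, ← smul_eq_mul, map_smul, smul_eq_mul, mul_comm]
  refine ⟨fun i => l i 1, c, fun i r => ?_, fun r b hb => ?_⟩
  · rw [← hl]; exact h1 i r
  · have := congrFun h2 r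
    rw [← this, iSup_apply]
    refine ciSup_le fun i => ?_
    have := hb i
    rw [← hl] at this
    exact this

/-! ### Minimisation of uniformly convex functionals -/

/-- A functional which is bounded below and uniformly convex at midpoints attains its minimum on a
closed set, provided it is continuous along a subsequence of each convergent sequence. -/
theorem exists_forall_le_of_midpoint {H : Type*} [NormedAddCommGroup H] [NormedSpace ℝ H]
    [CompleteSpace H] {K : Set H} (hne : K.Nonempty) (hK : IsClosed K) {Φ : H → ℝ} {b c : ℝ}
    (hc : 0 < c) (hb : ∀ x ∈ K, b ≤ Φ x)
    (hmem : ∀ x ∈ K, ∀ y ∈ K, (1 / 2 : ℝ) • (x + y) ∈ K)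
    (hmid : ∀ x ∈ K, ∀ y ∈ K,
      Φ ((1 / 2 : ℝ) • (x + y)) ≤ 1 / 2 * Φ x + 1 / 2 * Φ y - c * ‖x - y‖ ^ 2)
    (hlim : ∀ (x : ℕ → H) (y : H), (∀ k, x k ∈ K) → Tendsto x atTop (𝓝 y) →
      ∃ ns : ℕ → ℕ, StrictMono ns ∧ Tendsto (fun k => Φ (x (ns k))) atTop (𝓝 (Φ y))) :
    ∃ x ∈ K, ∀ y ∈ K, Φ x ≤ Φ y := by
  set I := sInf (Φ '' K) with hI
  have hbdd : BddBelow (Φ '' K) := ⟨b, by rintro _ ⟨x, hx, rfl⟩; exact hb x hx⟩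
  have hIle : ∀ x ∈ K, I ≤ Φ x := fun x hx => csInf_le hbdd ⟨x, hx, rfl⟩
  have hex : ∀ k : ℕ, ∃ x ∈ K, Φ x < I + 1 / ((k : ℝ) + 1) := fun k => by
    obtain ⟨_, ⟨x, hx, rfl⟩, h⟩ := exists_lt_of_csInf_lt (hne.image Φ)
      (show sInf (Φ '' K) < I + 1 / ((k : ℝ) + 1) from lt_add_of_pos_right _ (by positivity))
    exact ⟨x, hx, h⟩
  choose x hxK hxI using hex
  have hto : Tendsto (fun k : ℕ => 1 / ((k : ℝ) + 1)) atTop (𝓝 0) :=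
    tendsto_one_div_add_atTop_nhds_zero_nat
  -- The midpoint of two near-minimisers still has value at least `I`, so `c ‖x - y‖²` is at most
  -- the mean of their excesses over `I`.
  have hcauchy : CauchySeq x := by
    rw [Metric.cauchySeq_iff']
    intro ε hε
    have hev : ∀ᶠ k : ℕ in atTop, 1 / ((k : ℝ) + 1) < c * ε ^ 2 :=
      hto.eventually (gt_mem_nhds (by positivity))
    obtain ⟨N, hN⟩ := eventually_atTop.1 hev
    refine ⟨N, fun n hn => ?_⟩
    have h1 := hmid _ (hxK n) _ (hxK N)
    have h2 := hIle _ (hmem _ (hxK n) _ (hxK N))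
    have h3 : c * ‖x n - x N‖ ^ 2 < c * ε ^ 2 := by
      linarith [hxI n, hxI N, hN n hn, hN N le_rfl]
    rw [dist_eq_norm]
    exact lt_of_pow_lt_pow_left₀ 2 hε.le (lt_of_mul_lt_mul_left h3 hc.le)
  obtain ⟨y, hy⟩ := cauchySeq_tendsto_of_complete hcauchy
  obtain ⟨ns, hns, hlimΦ⟩ := hlim x y hxK hy
  refine ⟨y, hK.mem_of_tendsto hy (Eventually.of_forall hxK), fun z hz => ?_⟩
  refine le_trans (le_of_tendsto_of_tendsto' hlimΦ
    ((tendsto_const_nhds (x := I)).add (hto.comp hns.tendsto_atTop)) fun k => (hxI (ns k)).le) ?_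
  rw [add_zero]
  exact hIle z hz

/-! ### Weak compactness -/

/-- A bounded sequence of a Hilbert space converges weakly along any ultrafilter. -/
theorem exists_weak_limit_of_bounded {H : Type*} [NormedAddCommGroup H] [InnerProductSpace ℝ H]
    [CompleteSpace H] {ι : Type*} (U : Ultrafilter ι) {x : ι → H} {B : ℝ} (hB : ∀ n, ‖x n‖ ≤ B) :
    ∃ v : H, ∀ φ : H, Tendsto (fun n => ⟪x n, φ⟫) U (𝓝 ⟪v, φ⟫) := by
  have hbd : ∀ φ n, |⟪x n, φ⟫| ≤ B * ‖φ‖ := fun φ n =>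
    (abs_real_inner_le_norm _ _).trans (mul_le_mul_of_nonneg_right (hB n) (norm_nonneg _))
  -- Each scalar sequence stays in a compact interval, so the ultrafilter makes all of them converge
  -- at once. The limits are linear and bounded in `φ`, and Riesz representation gives `v`.
  have hex : ∀ φ : H, ∃ a ∈ Icc (-(B * ‖φ‖)) (B * ‖φ‖), Tendsto (fun n => ⟪x n, φ⟫) U (𝓝 a) := by
    intro φ
    obtain ⟨a, ha, h⟩ := isCompact_Icc.ultrafilter_le_nhds
      (U.map fun n => ⟪x n, φ⟫) (s := Icc (-(B * ‖φ‖)) (B * ‖φ‖))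
      (le_principal_iff.2 (Filter.mem_map.2
        (Filter.Eventually.of_forall fun n => abs_le.1 (hbd φ n))))
    exact ⟨a, ha, h⟩
  choose a ha hlim using hex
  let L : H →ₗ[ℝ] ℝ :=
    { toFun := a
      map_add' := fun φ ψ => tendsto_nhds_unique (hlim (φ + ψ)) <| by
        simpa only [inner_add_right] using (hlim φ).add (hlim ψ)
      map_smul' := fun r φ => tendsto_nhds_unique (hlim (r • φ)) <| by
        simpa only [real_inner_smul_right, RingHom.id_apply, smul_eq_mul] using
          (hlim φ).const_mul r }
  let T : StrongDual ℝ H := L.mkContinuous B fun φ => abs_le.2 (ha φ)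
  refine ⟨(InnerProductSpace.toDual ℝ H).symm T, fun φ => ?_⟩
  rw [InnerProductSpace.toDual_symm_apply]
  exact hlim φ

/-! ### Truncation and weak compactness in `L¹` -/

/-- The truncation of a real number at height `M`. -/
def truncate (M r : ℝ) : ℝ := max (-M) (min M r)

theorem continuous_truncate (M : ℝ) : Continuous (truncate M) := by
  unfold truncate; fun_prop

theorem abs_truncate_le {M : ℝ} (hM : 0 ≤ M) (r : ℝ) : |truncate M r| ≤ M :=
  abs_le.2 ⟨le_max_left _ _, max_le (by linarith) (min_le_left _ _)⟩

theorem truncate_eq_self {M r : ℝ} (h : |r| ≤ M) : truncate M r = r := by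
  rw [truncate, min_eq_right (abs_le.1 h).2, max_eq_right (abs_le.1 h).1]

theorem abs_sub_truncate_le {M : ℝ} (hM : 0 ≤ M) (r : ℝ) : |r - truncate M r| ≤ |r| := by
  unfold truncate
  rcases le_total M r with h | h
  · rw [min_eq_left h, max_eq_right (by linarith), abs_of_nonneg (by linarith),
      abs_of_nonneg (by linarith)]
    linarith
  · rw [min_eq_right h]
    rcases le_total (-M) r with h' | h'
    · rw [max_eq_right h', sub_self, abs_zero]; exact abs_nonneg r
    · rw [max_eq_left h', abs_of_nonpos (by linarith), abs_of_nonpos (by linarith)]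
      linarith

theorem integrable_mul_of_ae_bound {α : Type*} [MeasurableSpace α] {μ : Measure α} {f φ : α → ℝ}
    (hf : Integrable f μ) (hφ : AEStronglyMeasurable φ μ) {B : ℝ} (hB : ∀ᵐ x ∂μ, |φ x| ≤ B) :
    Integrable (fun x => f x * φ x) μ :=
  hf.mul_bdd (c := B) hφ (by simpa only [Real.norm_eq_abs] using hB)

theorem abs_integral_mul_le {α : Type*} [MeasurableSpace α] {μ : Measure α} {f φ : α → ℝ}
    (hf : Integrable f μ) {B : ℝ}
    (hB : ∀ᵐ x ∂μ, |φ x| ≤ B) : |∫ x, f x * φ x ∂μ| ≤ B * ∫ x, |f x| ∂μ := by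
  rw [← integral_const_mul]
  refine norm_integral_le_of_norm_le (f := fun x => f x * φ x) (hf.abs.const_mul B) ?_
  filter_upwards [hB] with x hx
  rw [norm_mul, Real.norm_eq_abs, Real.norm_eq_abs, mul_comm]
  exact mul_le_mul_of_nonneg_right hx (abs_nonneg _)

/-- A uniformly integrable sequence on a finite measure space converges weakly in `L¹` along any
ultrafilter. -/
theorem exists_weak_L1_limit {α ι : Type*} [MeasurableSpace α] {μ : Measure α} [IsFiniteMeasure μ]
    (U : Ultrafilter ι) {u : ι → α → ℝ} (hu : ∀ n, Integrable (u n) μ)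
    (hUI : ∀ ε > 0, ∃ M > 0, ∀ n, ∫ x, |u n x - truncate M (u n x)| ∂μ ≤ ε) :
    ∃ v : Lp ℝ 1 μ, ∀ (φ : α → ℝ) (B : ℝ), AEStronglyMeasurable φ μ → (∀ᵐ x ∂μ, |φ x| ≤ B) →
      Tendsto (fun n => ∫ x, u n x * φ x ∂μ) U (𝓝 (∫ x, v x * φ x ∂μ)) := by
  have hpos : ∀ k : ℕ, (0 : ℝ) < 1 / ((k : ℝ) + 1) := fun k => by positivity
  choose M hM0 hM using fun k => hUI _ (hpos k)
  have hTm : ∀ k n, AEStronglyMeasurable (fun x => truncate (M k) (u n x)) μ := fun k n =>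
    (continuous_truncate _).comp_aestronglyMeasurable (hu n).aestronglyMeasurable
  have hTb : ∀ k n, ∀ᵐ x ∂μ, |truncate (M k) (u n x)| ≤ M k := fun k n =>
    Eventually.of_forall fun x => abs_truncate_le (hM0 k).le _
  have hT2 : ∀ k n, MemLp (fun x => truncate (M k) (u n x)) 2 μ := fun k n =>
    MemLp.of_bound (hTm k n) (M k) (by simpa only [Real.norm_eq_abs] using hTb k n)
  have hT1 : ∀ k n, Integrable (fun x => truncate (M k) (u n x)) μ := fun k n =>
    (hT2 k n).integrable (by norm_num)
  -- At a fixed height the truncations are bounded in `L²`, since the measure is finite; their weak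
  -- `L²` limits `V k` should approximate the desired `L¹` limit.
  have hex : ∀ k, ∃ V : Lp ℝ 2 μ, ∀ φ : Lp ℝ 2 μ,
      Tendsto (fun n => ⟪(hT2 k n).toLp _, φ⟫) U (𝓝 ⟪V, φ⟫) := fun k => by
    refine exists_weak_limit_of_bounded U
      (B := (measureUnivNNReal μ : ℝ) ^ (2 : ENNReal).toReal⁻¹ * M k) fun n => ?_
    refine Lp.norm_le_of_ae_bound (hM0 k).le ?_
    filter_upwards [(hT2 k n).coeFn_toLp] with x hx
    rw [hx]
    exact abs_truncate_le (hM0 k).le _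
  choose V hV using hex
  have hV1 : ∀ k, Integrable (V k) μ := fun k => (Lp.memLp (V k)).integrable (by norm_num)
  have hVlim : ∀ (k : ℕ) (φ : α → ℝ) (B : ℝ), AEStronglyMeasurable φ μ →
      (∀ᵐ x ∂μ, |φ x| ≤ B) → Tendsto (fun n => ∫ x, truncate (M k) (u n x) * φ x ∂μ) U
        (𝓝 (∫ x, V k x * φ x ∂μ)) := by
    intro k φ B hφ hB
    have hφ2 : MemLp φ 2 μ := MemLp.of_bound hφ B (by simpa only [Real.norm_eq_abs] using hB)
    have h := hV k (hφ2.toLp φ)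
    have e1 : ⟪V k, hφ2.toLp φ⟫ = ∫ x, V k x * φ x ∂μ := by
      rw [L2.inner_def]
      refine integral_congr_ae ?_
      filter_upwards [hφ2.coeFn_toLp] with x hx
      rw [hx]; simp [mul_comm]
    have e2 : ∀ n, ⟪(hT2 k n).toLp _, hφ2.toLp φ⟫ = ∫ x, truncate (M k) (u n x) * φ x ∂μ := by
      intro n
      rw [L2.inner_def]
      refine integral_congr_ae ?_
      filter_upwards [hφ2.coeFn_toLp, (hT2 k n).coeFn_toLp] with x hx hx'
      rw [hx, hx']; simp [mul_comm]
    simpa only [e1, e2] using h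
  have hsub : ∀ k n, Integrable (fun x => u n x - truncate (M k) (u n x)) μ := fun k n =>
    (hu n).sub (hT1 k n)
  let W : ℕ → Lp ℝ 1 μ := fun k => (memLp_one_iff_integrable.2 (hV1 k)).toLp (V k)
  have hWV : ∀ k, W k =ᵐ[μ] V k := fun k => MemLp.coeFn_toLp _
  have hWdist : ∀ k l, dist (W k) (W l) ≤ 1 / ((k : ℝ) + 1) + 1 / ((l : ℝ) + 1) := by
    intro k l
    -- Testing with the sign of `V k - V l` turns the `L¹` distance into a weak limit, which the two
    -- truncation errors bound.
    set s : α → ℝ := fun x => if 0 ≤ V k x - V l x then 1 else -1 with hs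
    have hsm : AEStronglyMeasurable s μ := by
      refine (Measurable.ite ?_ measurable_const measurable_const).aestronglyMeasurable
      exact measurableSet_le measurable_const
        ((Lp.stronglyMeasurable (V k)).measurable.sub (Lp.stronglyMeasurable (V l)).measurable)
    have hsb : ∀ᵐ x ∂μ, |s x| ≤ 1 := Eventually.of_forall fun x => by
      simp only [hs]; split_ifs <;> simp
    have e : dist (W k) (W l) = ∫ x, V k x * s x ∂μ - ∫ x, V l x * s x ∂μ := by
      rw [dist_eq_norm, L1.norm_eq_integral_norm,
        ← integral_sub (integrable_mul_of_ae_bound (hV1 k) hsm hsb)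
          (integrable_mul_of_ae_bound (hV1 l) hsm hsb)]
      refine integral_congr_ae ?_
      filter_upwards [Lp.coeFn_sub (W k) (W l), hWV k, hWV l] with x h1 h2 h3
      rw [h1, Pi.sub_apply, h2, h3, Real.norm_eq_abs]
      simp only [hs]
      split_ifs with h
      · rw [abs_of_nonneg h]; ring
      · rw [abs_of_neg (not_le.1 h)]; ring
    rw [e]
    refine le_of_tendsto ((hVlim k s 1 hsm hsb).sub (hVlim l s 1 hsm hsb))
      (Eventually.of_forall fun n => ?_)
    have h1 := abs_le.1 ((abs_integral_mul_le (hsub k n) hsb).trans_eq (one_mul _))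
    have h2 := abs_le.1 ((abs_integral_mul_le (hsub l n) hsb).trans_eq (one_mul _))
    simp only [sub_mul] at h1 h2
    rw [integral_sub (integrable_mul_of_ae_bound (hu n) hsm hsb)
      (integrable_mul_of_ae_bound (hT1 _ n) hsm hsb)] at h1 h2
    linarith [h1.2, h2.1, h1.1, h2.2, hM k n, hM l n]
  have hto : Tendsto (fun k : ℕ => 1 / ((k : ℝ) + 1)) atTop (𝓝 0) :=
    tendsto_one_div_add_atTop_nhds_zero_nat
  have hcauchy : CauchySeq W := by
    refine cauchySeq_of_le_tendsto_0 (fun k : ℕ => 1 / ((k : ℝ) + 1) + 1 / ((k : ℝ) + 1))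
      (fun n m N hn hm => (hWdist n m).trans ?_) (by simpa using hto.add hto)
    exact add_le_add (Nat.one_div_le_one_div hn) (Nat.one_div_le_one_div hm)
  obtain ⟨v, hv⟩ := cauchySeq_tendsto_of_complete hcauchy
  refine ⟨v, fun φ B hφ hB => ?_⟩
  have hB' : ∀ᵐ x ∂μ, |φ x| ≤ |B| := hB.mono fun x hx => hx.trans (le_abs_self B)
  have hv1 : Integrable v μ := L1.integrable_coeFn v
  rw [Metric.tendsto_nhds]
  intro ε hε
  have hlim0 : Tendsto (fun k : ℕ => |B| * (1 / ((k : ℝ) + 1)) + |B| * dist (W k) v) atTop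
      (𝓝 0) := by
    simpa using (hto.const_mul |B|).add ((tendsto_iff_dist_tendsto_zero.1 hv).const_mul |B|)
  obtain ⟨k, hk⟩ := (hlim0.eventually (gt_mem_nhds (half_pos hε))).exists
  -- Three errors: truncation of `u n`, uniform in `n`; weak convergence at height `M k`; and the
  -- distance from `W k` to `v`. The first and third together are below `ε / 2` by the choice of
  -- `k`.
  filter_upwards [Metric.tendsto_nhds.1 (hVlim k φ _ hφ hB') (ε / 2) (half_pos hε)] with n hn
  have h1 : |∫ x, u n x * φ x ∂μ - ∫ x, truncate (M k) (u n x) * φ x ∂μ|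
      ≤ |B| * (1 / ((k : ℝ) + 1)) := by
    rw [← integral_sub (integrable_mul_of_ae_bound (hu n) hφ hB')
      (integrable_mul_of_ae_bound (hT1 k n) hφ hB')]
    simp only [← sub_mul]
    exact (abs_integral_mul_le (hsub k n) hB').trans
      (mul_le_mul_of_nonneg_left (hM k n) (abs_nonneg B))
  have h2 : |∫ x, V k x * φ x ∂μ - ∫ x, v x * φ x ∂μ| ≤ |B| * dist (W k) v := by
    rw [← integral_sub (integrable_mul_of_ae_bound (hV1 k) hφ hB')
      (integrable_mul_of_ae_bound hv1 hφ hB')]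
    simp only [← sub_mul]
    refine (abs_integral_mul_le ((hV1 k).sub hv1) hB').trans (le_of_eq ?_)
    rw [dist_eq_norm, L1.norm_eq_integral_norm]
    congr 1
    refine integral_congr_ae ?_
    filter_upwards [Lp.coeFn_sub (W k) v, hWV k] with x h1 h2
    rw [h1, Pi.sub_apply, Pi.sub_apply, h2, Real.norm_eq_abs]
  rw [Real.dist_eq] at hn ⊢
  rw [abs_lt] at hn ⊢
  have h1' := abs_le.1 h1
  have h2' := abs_le.1 h2
  constructor <;> linarith [h1'.1, h1'.2, h2'.1, h2'.2, hn.1, hn.2]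

/-- Multiplication of an `L²`-convergent sequence by uniformly bounded, almost everywhere convergent
scalar functions. -/
theorem tendsto_Lp_of_smul {α E : Type*} [MeasurableSpace α] {μ : Measure α}
    [NormedAddCommGroup E] [InnerProductSpace ℝ E] {g : ℕ → Lp E 2 μ} {g₀ : Lp E 2 μ}
    (hg : Tendsto g atTop (𝓝 g₀)) {c : ℕ → α → ℝ} {c₀ : α → ℝ}
    (hc : ∀ n, AEStronglyMeasurable (c n) μ) (hb : ∀ n x, |c n x| ≤ 1) (hb₀ : ∀ x, |c₀ x| ≤ 1)
    (hlim : ∀ᵐ x ∂μ, Tendsto (fun n => c n x) atTop (𝓝 (c₀ x)))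
    {F : ℕ → Lp E 2 μ} {F₀ : Lp E 2 μ} (hF : ∀ n, F n =ᵐ[μ] fun x => c n x • g n x)
    (hF₀ : F₀ =ᵐ[μ] fun x => c₀ x • g₀ x) : Tendsto F atTop (𝓝 F₀) := by
  have hm : ∀ n, MemLp (fun x => c n x • g₀ x) 2 μ := fun n =>
    (Lp.memLp g₀).of_le ((hc n).smul (Lp.aestronglyMeasurable g₀)) (Eventually.of_forall fun x => by
      rw [norm_smul, Real.norm_eq_abs]
      exact mul_le_of_le_one_left (norm_nonneg _) (hb n x))
  -- Split `F n - F₀` as `c n • (g n - g₀) + (c n - c₀) • g₀`: the first term is controlled by `|c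
  -- n| ≤ 1`, the second by dominated convergence with majorant `4 ‖g₀‖²`.
  have h1 : ∀ n, ‖F n - (hm n).toLp _‖ ≤ ‖g n - g₀‖ := fun n => by
    refine Lp.norm_le_norm_of_ae_le ?_
    filter_upwards [Lp.coeFn_sub (F n) ((hm n).toLp _), Lp.coeFn_sub (g n) g₀, (hm n).coeFn_toLp,
      hF n] with x e1 e2 e3 e4
    rw [e1, e2, Pi.sub_apply, Pi.sub_apply, e3, e4, ← smul_sub, norm_smul, Real.norm_eq_abs]
    exact mul_le_of_le_one_left (norm_nonneg _) (hb n x)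
  have h2 : Tendsto (fun n => (hm n).toLp (fun x => c n x • g₀ x) - F₀) atTop (𝓝 0) := by
    rw [tendsto_zero_iff_norm_tendsto_zero]
    have hsq : ∀ f : Lp E 2 μ, ‖f‖ ^ 2 = ∫ x, ‖f x‖ ^ 2 ∂μ := fun f => by
      rw [← real_inner_self_eq_norm_sq, L2.inner_def]
      simp only [real_inner_self_eq_norm_sq]
    have h3 : Tendsto (fun n => ‖(hm n).toLp (fun x => c n x • g₀ x) - F₀‖ ^ 2) atTop (𝓝 0) := by
      simp only [hsq]
      rw [← integral_zero α ℝ (μ := μ)]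
      refine tendsto_integral_filter_of_dominated_convergence (fun x => 4 * ‖g₀ x‖ ^ 2)
        (Eventually.of_forall fun n => ?_) (Eventually.of_forall fun n => ?_) ?_ ?_
      · exact (Lp.aestronglyMeasurable _).norm.pow 2
      · filter_upwards [Lp.coeFn_sub ((hm n).toLp _) F₀, (hm n).coeFn_toLp, hF₀] with x e1 e2 e3
        rw [e1, Pi.sub_apply, e2, e3, ← sub_smul, norm_smul, Real.norm_eq_abs, Real.norm_eq_abs,
          abs_of_nonneg (by positivity), mul_pow]
        refine mul_le_mul_of_nonneg_right ?_ (by positivity)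
        have := abs_le.1 (hb n x)
        have := abs_le.1 (hb₀ x)
        rw [sq_abs]
        nlinarith
      · exact ((Lp.memLp g₀).integrable_norm_pow (by simp)).const_mul 4
      · have hall : ∀ᵐ x ∂μ, ∀ n, ((hm n).toLp (fun x => c n x • g₀ x) - F₀ : Lp E 2 μ) x
            = (c n x - c₀ x) • g₀ x := by
          rw [ae_all_iff]
          intro n
          filter_upwards [Lp.coeFn_sub ((hm n).toLp _) F₀, (hm n).coeFn_toLp, hF₀] with x e1 e2 e3
          rw [e1, Pi.sub_apply, e2, e3, ← sub_smul]
        filter_upwards [hall, hlim] with x hx hx'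
        simp only [hx]
        have : Tendsto (fun n => c n x - c₀ x) atTop (𝓝 0) := by
          simpa using hx'.sub_const (c₀ x)
        simpa using ((this.smul_const (g₀ x)).norm.pow 2)
    have := h3.sqrt
    simpa [Real.sqrt_sq (norm_nonneg _)] using this
  have h3 : Tendsto (fun n => F n - (hm n).toLp (fun x => c n x • g₀ x)) atTop (𝓝 0) :=
    squeeze_zero_norm h1 (tendsto_iff_norm_sub_tendsto_zero.1 hg)
  have := h3.add h2
  simp only [sub_add_sub_cancel, add_zero] at this
  simpa using this.add_const F₀

/-! ### Smooth bounded cut-offs in `H¹₀` and the product of `H¹₀` with `L¹ ∩ H⁻¹` -/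

/-- A smooth approximation of the identity, bounded when `ε > 0`. -/
noncomputable def cutoff (ε r : ℝ) : ℝ := r / (1 + ε * r ^ 2)

/-- The derivative of `cutoff ε`. -/
noncomputable def cutoffDeriv (ε r : ℝ) : ℝ := (1 - ε * r ^ 2) / (1 + ε * r ^ 2) ^ 2

theorem one_add_mul_sq_pos {ε : ℝ} (hε : 0 ≤ ε) (r : ℝ) : 0 < 1 + ε * r ^ 2 := by positivity

theorem contDiff_cutoff {ε : ℝ} (hε : 0 ≤ ε) {n : WithTop ℕ∞} : ContDiff ℝ n (cutoff ε) :=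
  contDiff_id.div (contDiff_const.add (contDiff_const.mul (contDiff_id.pow 2)))
    fun r => (one_add_mul_sq_pos hε r).ne'

theorem hasDerivAt_cutoff {ε : ℝ} (hε : 0 ≤ ε) (r : ℝ) :
    HasDerivAt (cutoff ε) (cutoffDeriv ε r) r := by
  have h := (hasDerivAt_id r).div ((((hasDerivAt_id r).pow 2).const_mul ε).const_add 1)
    (one_add_mul_sq_pos hε r).ne'
  refine h.congr_deriv ?_
  simp only [cutoffDeriv, id, Pi.pow_apply]
  congr 1
  push_cast
  ring

/-- Exhibits the cut-off as multiplication by a factor in `(0, 1]` when `ε ≥ 0`, the form to which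
`tendsto_Lp_of_smul` applies and which preserves one-sided bounds. -/
theorem cutoff_eq_mul (ε r : ℝ) : cutoff ε r = (1 + ε * r ^ 2)⁻¹ * r := by
  rw [cutoff, div_eq_inv_mul]

theorem abs_inv_one_add_mul_sq_le {ε : ℝ} (hε : 0 ≤ ε) (r : ℝ) : |(1 + ε * r ^ 2)⁻¹| ≤ 1 := by
  rw [abs_inv, abs_of_pos (one_add_mul_sq_pos hε r)]
  exact inv_le_one_of_one_le₀ (le_add_of_nonneg_right (by positivity))

/-- With `t = ε r² ≥ 0`, one has `|1 - t| ≤ 1 + t ≤ (1 + t)²`. -/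
theorem abs_cutoffDeriv_le {ε : ℝ} (hε : 0 ≤ ε) (r : ℝ) : |cutoffDeriv ε r| ≤ 1 := by
  have h : 0 ≤ ε * r ^ 2 := by positivity
  rw [cutoffDeriv, abs_div, abs_of_pos (pow_pos (one_add_mul_sq_pos hε r) 2),
    div_le_one (by positivity), abs_le]
  constructor <;> nlinarith

/-- After clearing the denominator this follows from `|r| ≤ 1 + r²` and `1 ≤ ε⁻¹`. The bound is
crude, but only its finiteness for fixed `ε` matters. -/
theorem abs_cutoff_le {ε : ℝ} (hε : 0 < ε) (hε1 : ε ≤ 1) (r : ℝ) : |cutoff ε r| ≤ ε⁻¹ := by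
  rw [cutoff, abs_div, abs_of_pos (one_add_mul_sq_pos hε.le r),
    div_le_iff₀ (one_add_mul_sq_pos hε.le r), mul_add, ← mul_assoc, inv_mul_cancel₀ hε.ne']
  have h1 : 1 ≤ ε⁻¹ := (one_le_inv₀ hε).2 hε1
  have h2 : |r| ^ 2 = r ^ 2 := sq_abs r
  nlinarith [sq_nonneg (|r| - 1)]

theorem continuous_cutoffDeriv {ε : ℝ} (hε : 0 ≤ ε) : Continuous (cutoffDeriv ε) :=
  Continuous.div (by fun_prop) (by fun_prop) fun r => (pow_pos (one_add_mul_sq_pos hε r) 2).ne'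

theorem continuous_inv_one_add_mul_sq {ε : ℝ} (hε : 0 ≤ ε) :
    Continuous fun r : ℝ => (1 + ε * r ^ 2)⁻¹ :=
  Continuous.inv₀ (by fun_prop) fun r => (one_add_mul_sq_pos hε r).ne'

namespace ImageRestoration

variable {d : ℕ} {Ω : Opens (Rd d)}

/-- The cut-off of a test function. -/
noncomputable def cutoffTest {ε : ℝ} (hε : 0 ≤ ε) (φ : 𝓓(Ω, ℝ)) : 𝓓(Ω, ℝ) where
  toFun := cutoff ε ∘ φ
  contDiff' := (contDiff_cutoff hε).comp φ.contDiff
  hasCompactSupport' := φ.hasCompactSupport.comp_left (by simp [cutoff])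
  tsupport_subset' := (tsupport_comp_subset (by simp [cutoff]) _).trans φ.tsupport_subset

theorem gradient_cutoffTest {ε : ℝ} (hε : 0 ≤ ε) (φ : 𝓓(Ω, ℝ)) (x : Rd d) :
    ∇ (cutoffTest hε φ : Rd d → ℝ) x = cutoffDeriv ε (φ x) • ∇ (φ : Rd d → ℝ) x := by
  have h1 : DifferentiableAt ℝ φ x := φ.contDiff.differentiable (by simp) x
  have h2 := (hasDerivAt_cutoff hε (φ x)).comp_hasFDerivAt x h1.hasFDerivAt
  have h3 : fderiv ℝ (cutoffTest hε φ : Rd d → ℝ) x = cutoffDeriv ε (φ x) • fderiv ℝ φ x :=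
    h2.fderiv
  rw [gradient, gradient, h3, map_smul]

theorem H10.continuous_fn : Continuous fun v : H10 Ω => H10.fn v :=
  (WithLp.fstL 2 ℝ _ _).continuous.comp continuous_subtype_val

theorem H10.continuous_grad : Continuous fun v : H10 Ω => H10.grad v :=
  (WithLp.sndL 2 ℝ _ _).continuous.comp continuous_subtype_val

theorem H10.tendsto_iff {ι : Type*} {l : Filter ι} {w : ι → H10 Ω} {z : H10 Ω} :
    Tendsto w l (𝓝 z) ↔ Tendsto (fun k => fn (w k)) l (𝓝 (fn z)) ∧
      Tendsto (fun k => grad (w k)) l (𝓝 (grad z)) := by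
  refine ⟨fun h => ⟨(H10.continuous_fn.tendsto z).comp h, (H10.continuous_grad.tendsto z).comp h⟩,
    fun h => tendsto_subtype_rng.2 ?_⟩
  exact ((WithLp.prod_continuous_toLp 2 _ _).tendsto _).comp (h.1.prodMk_nhds h.2)

/-- The cut-off of an element of `H¹₀(Ω)` belongs to `H¹₀(Ω)` and is approximated by uniformly
bounded test functions. -/
theorem H10.exists_cutoff {ε : ℝ} (hε : 0 ≤ ε) (w : H10 Ω) :
    ∃ z : H10 Ω, (fn z =ᵐ[vol Ω] fun x => (1 + ε * fn w x ^ 2)⁻¹ • fn w x) ∧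
      (grad z =ᵐ[vol Ω] fun x => cutoffDeriv ε (fn w x) • grad w x) ∧
      ∃ φ : ℕ → 𝓓(Ω, ℝ), Tendsto (fun k => ofTest (cutoffTest hε (φ k))) atTop (𝓝 z) ∧
        ∀ᵐ x ∂(vol Ω), Tendsto (fun k => cutoffTest hε (φ k) x) atTop (𝓝 (cutoff ε (fn w x))) := by
  obtain ⟨φ, hφ⟩ := exists_seq_test w
  -- The multipliers depend on the function values, so almost everywhere convergence is needed and a
  -- subsequence is extracted.
  obtain ⟨ns, hns, hae⟩ := (tendstoInMeasure_of_tendsto_Lp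
    ((H10.continuous_fn.tendsto w).comp hφ)).exists_seq_tendsto_ae
  have hφ' := hφ.comp hns.tendsto_atTop
  have hae' : ∀ᵐ x ∂(vol Ω), Tendsto (fun k => φ (ns k) x) atTop (𝓝 (fn w x)) := by
    have : ∀ᵐ x ∂(vol Ω), ∀ k, fn (ofTest (φ (ns k))) x = φ (ns k) x :=
      ae_all_iff.2 fun k => fn_ofTest _
    filter_upwards [hae, this] with x h1 h2
    simpa only [Function.comp_apply, h2] using h1
  have hwm : AEStronglyMeasurable (fn w) (vol Ω) := Lp.aestronglyMeasurable _
  have hm1 : MemLp (fun x => (1 + ε * fn w x ^ 2)⁻¹ • fn w x) 2 (vol Ω) :=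
    (Lp.memLp (fn w)).of_le
      (((continuous_inv_one_add_mul_sq hε).comp_aestronglyMeasurable hwm).smul hwm)
      (Eventually.of_forall fun x => by
        rw [norm_smul]
        exact mul_le_of_le_one_left (norm_nonneg _) (abs_inv_one_add_mul_sq_le hε _))
  have hm2 : MemLp (fun x => cutoffDeriv ε (fn w x) • grad w x) 2 (vol Ω) :=
    (Lp.memLp (grad w)).of_le
      (((continuous_cutoffDeriv hε).comp_aestronglyMeasurable hwm).smul
        (Lp.aestronglyMeasurable _))
      (Eventually.of_forall fun x => by
        rw [norm_smul]
        exact mul_le_of_le_one_left (norm_nonneg _) (abs_cutoffDeriv_le hε _))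
  have hlim1 : Tendsto (fun k => fn (ofTest (cutoffTest hε (φ (ns k))))) atTop
      (𝓝 (hm1.toLp _)) := by
    refine tendsto_Lp_of_smul ((H10.continuous_fn.tendsto w).comp hφ')
      (c := fun k x => (1 + ε * φ (ns k) x ^ 2)⁻¹) (c₀ := fun x => (1 + ε * fn w x ^ 2)⁻¹)
      (fun k => ((continuous_inv_one_add_mul_sq hε).comp (φ (ns k)).continuous).aestronglyMeasurable)
      (fun k x => abs_inv_one_add_mul_sq_le hε _) (fun x => abs_inv_one_add_mul_sq_le hε _)
      ?_ (fun k => ?_) hm1.coeFn_toLp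
    · filter_upwards [hae'] with x hx
      exact ((continuous_inv_one_add_mul_sq hε).tendsto _).comp hx
    · filter_upwards [fn_ofTest (cutoffTest hε (φ (ns k))), fn_ofTest (φ (ns k))] with x h1 h2
      rw [h1, Function.comp_apply, Function.comp_apply, h2]
      exact cutoff_eq_mul _ _
  have hlim2 : Tendsto (fun k => grad (ofTest (cutoffTest hε (φ (ns k))))) atTop
      (𝓝 (hm2.toLp _)) := by
    refine tendsto_Lp_of_smul ((H10.continuous_grad.tendsto w).comp hφ')
      (c := fun k x => cutoffDeriv ε (φ (ns k) x)) (c₀ := fun x => cutoffDeriv ε (fn w x))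
      (fun k => ((continuous_cutoffDeriv hε).comp (φ (ns k)).continuous).aestronglyMeasurable)
      (fun k x => abs_cutoffDeriv_le hε _) (fun x => abs_cutoffDeriv_le hε _)
      ?_ (fun k => ?_) hm2.coeFn_toLp
    · filter_upwards [hae'] with x hx
      exact ((continuous_cutoffDeriv hε).tendsto _).comp hx
    · filter_upwards [grad_ofTest (cutoffTest hε (φ (ns k))), grad_ofTest (φ (ns k))] with x h1 h2
      rw [h1, Function.comp_apply, Function.comp_apply, h2]
      exact gradient_cutoffTest hε _ x
  have hmem : (WithLp.toLp 2 (hm1.toLp _, hm2.toLp _) : L2Pair Ω) ∈ H10 Ω := by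
    refine (Submodule.isClosed_topologicalClosure (LinearMap.range (testPair Ω))).mem_of_tendsto
      (((WithLp.prod_continuous_toLp 2 _ _).tendsto _).comp (hlim1.prodMk_nhds hlim2))
      (Eventually.of_forall fun k => ?_)
    exact (ofTest (cutoffTest hε (φ (ns k)))).2
  refine ⟨⟨_, hmem⟩, hm1.coeFn_toLp, hm2.coeFn_toLp, φ ∘ ns, H10.tendsto_iff.2 ⟨hlim1, hlim2⟩, ?_⟩
  filter_upwards [hae'] with x hx
  exact ((contDiff_cutoff hε (n := 0)).continuous.tendsto _).comp hx

/-- If an integrable function `w` represents `G ∈ H⁻¹(Ω)` and, for some `η ∈ H¹₀(Ω)`, the product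
`w η` is bounded below by an integrable function, then `w η` is integrable and its integral is
`⟨G, η⟩`. -/
theorem integrable_mul_fn {w : Rd d → ℝ} (hw : Integrable w (vol Ω)) {G : Hm1 Ω}
    (hG : ∀ φ : 𝓓(Ω, ℝ), ∫ x in (Ω : Set (Rd d)), w x * φ x = G (H10.ofTest φ)) (η : H10 Ω)
    {h : Rd d → ℝ} (hh : Integrable h (vol Ω))
    (hle : ∀ᵐ x ∂(vol Ω), - h x ≤ w x * H10.fn η x) :
    Integrable (fun x => w x * H10.fn η x) (vol Ω) ∧
      ∫ x in (Ω : Set (Rd d)), w x * H10.fn η x = G η := by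
  have hε : ∀ n : ℕ, (0 : ℝ) < 1 / ((n : ℝ) + 1) := fun n => by positivity
  have hε1 : ∀ n : ℕ, 1 / ((n : ℝ) + 1) ≤ 1 := fun n => by
    rw [div_le_one (by positivity)]; linarith [n.cast_nonneg (α := ℝ)]
  have hεlim : Tendsto (fun n : ℕ => 1 / ((n : ℝ) + 1)) atTop (𝓝 0) :=
    tendsto_one_div_add_atTop_nhds_zero_nat
  set ε : ℕ → ℝ := fun n => 1 / ((n : ℝ) + 1)
  choose z hz1 hz2 φ hφ1 hφ2 using fun n => H10.exists_cutoff (hε n).le η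
  have hηm : AEStronglyMeasurable (H10.fn η) (vol Ω) := Lp.aestronglyMeasurable _
  have hθlim : ∀ r : ℝ, Tendsto (fun n => (1 + ε n * r ^ 2)⁻¹) atTop (𝓝 1) := fun r => by
    have : Tendsto (fun n => 1 + ε n * r ^ 2) atTop (𝓝 1) := by
      simpa using (hεlim.mul_const (r ^ 2)).const_add 1
    simpa using this.inv₀ one_ne_zero
  have hcm : ∀ n, AEStronglyMeasurable (fun x => cutoff (ε n) (H10.fn η x)) (vol Ω) := fun n =>
    (contDiff_cutoff (hε n).le (n := 0)).continuous.comp_aestronglyMeasurable hηm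
  have hcb : ∀ n, ∀ᵐ x ∂(vol Ω), |cutoff (ε n) (H10.fn η x)| ≤ (ε n)⁻¹ := fun n =>
    Eventually.of_forall fun x => abs_cutoff_le (hε n) (hε1 n) _
  -- For fixed `n` the cut-off test functions are uniformly bounded by `(ε n)⁻¹`, so the integrals
  -- against the merely integrable `w` converge by domination.
  have hGz : ∀ n, ∫ x in (Ω : Set (Rd d)), w x * cutoff (ε n) (H10.fn η x) = G (z n) := by
    intro n
    have h1 : Tendsto (fun k => G (H10.ofTest (cutoffTest (hε n).le (φ n k)))) atTop
      (𝓝 (G (z n))) := (G.continuous.tendsto _).comp (hφ1 n)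
    refine tendsto_nhds_unique ?_ h1
    simp only [← hG]
    refine tendsto_integral_filter_of_dominated_convergence (fun x => |w x| * (ε n)⁻¹)
      (Eventually.of_forall fun k => hw.aestronglyMeasurable.mul
        (TestFunction.continuous _).aestronglyMeasurable)
      (Eventually.of_forall fun k => Eventually.of_forall fun x => ?_) (hw.abs.mul_const _) ?_
    · rw [norm_mul, Real.norm_eq_abs, Real.norm_eq_abs]
      exact mul_le_mul_of_nonneg_left (abs_cutoff_le (hε n) (hε1 n) _) (abs_nonneg _)
    · filter_upwards [hφ2 n] with x hx using hx.const_mul _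
  have hzlim : Tendsto z atTop (𝓝 η) := by
    refine H10.tendsto_iff.2 ⟨?_, ?_⟩
    · refine tendsto_Lp_of_smul (tendsto_const_nhds (x := H10.fn η))
        (c := fun n x => (1 + ε n * H10.fn η x ^ 2)⁻¹) (c₀ := fun _ => 1)
        (fun n => (continuous_inv_one_add_mul_sq (hε n).le).comp_aestronglyMeasurable hηm)
        (fun n x => abs_inv_one_add_mul_sq_le (hε n).le _) (fun x => by simp)
        (Eventually.of_forall fun x => hθlim _) hz1 (by simp)
    · refine tendsto_Lp_of_smul (tendsto_const_nhds (x := H10.grad η))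
        (c := fun n x => cutoffDeriv (ε n) (H10.fn η x)) (c₀ := fun _ => 1)
        (fun n => (continuous_cutoffDeriv (hε n).le).comp_aestronglyMeasurable hηm)
        (fun n x => abs_cutoffDeriv_le (hε n).le _) (fun x => by simp)
        (Eventually.of_forall fun x => ?_) hz2 (by simp)
      have h1 : Tendsto (fun n => ε n * H10.fn η x ^ 2) atTop (𝓝 0) := by
        simpa using hεlim.mul_const (H10.fn η x ^ 2)
      have h2 := (h1.const_sub 1).div ((h1.const_add 1).pow 2) (by norm_num)
      simp only [sub_zero, add_zero, one_pow, div_one] at h2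
      exact h2
  have hGlim : Tendsto (fun n => ∫ x in (Ω : Set (Rd d)), w x * cutoff (ε n) (H10.fn η x)) atTop
      (𝓝 (G η)) := by
    simp only [hGz]
    exact (G.continuous.tendsto _).comp hzlim
  have hwc : ∀ n, Integrable (fun x => w x * cutoff (ε n) (H10.fn η x)) (vol Ω) := fun n =>
    integrable_mul_of_ae_bound hw (hcm n) (hcb n)
  have hptlim : ∀ x, Tendsto (fun n => w x * cutoff (ε n) (H10.fn η x)) atTop
      (𝓝 (w x * H10.fn η x)) := fun x => by
    simp only [cutoff_eq_mul]
    simpa using ((hθlim (H10.fn η x)).mul_const (H10.fn η x)).const_mul (w x)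
  -- The cut-off multiplies `w η` by a factor in `[0, 1]`, so the lower bound `-|h|` is kept for
  -- every `n`.
  have hlow : ∀ᵐ x ∂(vol Ω), ∀ n, 0 ≤ w x * cutoff (ε n) (H10.fn η x) + |h x| := by
    filter_upwards [hle] with x hx n
    have h1 := abs_le.1 (abs_inv_one_add_mul_sq_le (hε n).le (H10.fn η x))
    have h2 : 0 ≤ (1 + ε n * H10.fn η x ^ 2)⁻¹ :=
      (inv_pos.2 (one_add_mul_sq_pos (hε n).le _)).le
    rw [cutoff_eq_mul]
    have h3 : -|h x| ≤ w x * H10.fn η x := by linarith [le_abs_self (h x)]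
    nlinarith [mul_le_mul_of_nonneg_left h3 h2, abs_nonneg (h x)]
  have hint : Integrable (fun x => w x * H10.fn η x) (vol Ω) := by
    have hsum : Integrable (fun x => w x * H10.fn η x + |h x|) (vol Ω) := by
      refine ⟨(hw.aestronglyMeasurable.mul hηm).add hh.abs.aestronglyMeasurable, ?_⟩
      have hnn : ∀ᵐ x ∂(vol Ω), 0 ≤ w x * H10.fn η x + |h x| := by
        filter_upwards [hle] with x hx
        linarith [le_abs_self (h x)]
      rw [hasFiniteIntegral_iff_ofReal hnn]
      -- Fatou's lemma: the nonnegative integrands `w · cutoff + |h|` have convergent integrals,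
      -- because `G (z n) → G η`. This is where the one-sided bound yields integrability.
      have hlim2 : Tendsto (fun n => ∫⁻ x in (Ω : Set (Rd d)),
          ENNReal.ofReal (w x * cutoff (ε n) (H10.fn η x) + |h x|)) atTop
          (𝓝 (ENNReal.ofReal (G η + ∫ x in (Ω : Set (Rd d)), |h x|))) := by
        refine ((ENNReal.continuous_ofReal.tendsto _).comp (hGlim.add_const _)).congr fun n => ?_
        rw [Function.comp_apply, ← integral_add (hwc n) hh.abs]
        exact ofReal_integral_eq_lintegral_ofReal ((hwc n).add hh.abs)
          (hlow.mono fun x hx => hx n)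
      refine lt_of_le_of_lt ?_ (ENNReal.ofReal_lt_top (r := G η + ∫ x in (Ω : Set (Rd d)), |h x|))
      rw [← hlim2.liminf_eq]
      refine le_trans (le_of_eq ?_) (lintegral_liminf_le' fun n => ?_)
      · refine lintegral_congr fun x => ?_
        exact (((ENNReal.continuous_ofReal.tendsto _).comp
          ((hptlim x).add_const |h x|)).liminf_eq).symm
      · exact ((hwc n).add hh.abs).aestronglyMeasurable.aemeasurable.ennreal_ofReal
    exact (hsum.sub hh.abs).congr (Eventually.of_forall fun x => by simp)
  refine ⟨hint, tendsto_nhds_unique ?_ hGlim⟩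
  refine tendsto_integral_filter_of_dominated_convergence (fun x => |w x * H10.fn η x|)
    (Eventually.of_forall fun n => (hwc n).aestronglyMeasurable)
    (Eventually.of_forall fun n => Eventually.of_forall fun x => ?_) hint.abs
    (Eventually.of_forall hptlim)
  rw [cutoff_eq_mul, mul_left_comm, norm_mul, Real.norm_eq_abs, Real.norm_eq_abs]
  exact mul_le_of_le_one_left (abs_nonneg _) (abs_inv_one_add_mul_sq_le (hε n).le _)

end ImageRestoration

/-! ### The regularised problem -/

section Regularised

variable {α : Type*} [MeasurableSpace α] {μ : Measure α} {E : Type*} [NormedAddCommGroup E] [InnerProductSpace ℝ E]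

/-- The functions in `L²` which are bounded by `M` almost everywhere. -/
def boundedLp (μ : Measure α) (M : ℝ) : Set (Lp ℝ 2 μ) := {u | ∀ᵐ x ∂μ, |u x| ≤ M}

/-- The functional `∫ j(u) + δ/2 ‖u‖² + ½ ‖T u - e‖²` on `L²`. -/
noncomputable def regEnergy (j : ℝ → ℝ) (T : Lp ℝ 2 μ →L[ℝ] E) (e : E) (δ : ℝ) (u : Lp ℝ 2 μ) :
    ℝ :=
  (∫ x, j (u x) ∂μ) + δ / 2 * ‖u‖ ^ 2 + 1 / 2 * ‖T u - e‖ ^ 2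

theorem exists_bound_comp {j : ℝ → ℝ} (hj : Continuous j) (M : ℝ) :
    ∃ B, ∀ r, |r| ≤ M → |j r| ≤ B := by
  obtain ⟨B, hB⟩ := (isCompact_Icc (a := -M) (b := M)).exists_bound_of_continuousOn hj.continuousOn
  exact ⟨B, fun r hr => hB r (abs_le.1 hr)⟩

/-- An `L²`-convergent sequence has an almost everywhere convergent subsequence, along which the
pointwise bound passes to the limit. -/
theorem isClosed_boundedLp (M : ℝ) : IsClosed (boundedLp μ M) := by
  refine isClosed_of_closure_subset fun u hu => ?_
  obtain ⟨x, hx, hlim⟩ := mem_closure_iff_seq_limit.1 hu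
  obtain ⟨ns, -, hae⟩ := (tendstoInMeasure_of_tendsto_Lp hlim).exists_seq_tendsto_ae
  filter_upwards [hae, ae_all_iff.2 hx] with y h1 h2
  exact le_of_tendsto h1.abs (Eventually.of_forall fun k => h2 (ns k))

theorem coeFn_convexComb (u v : Lp ℝ 2 μ) (t : ℝ) :
    (u + t • (v - u) : Lp ℝ 2 μ) =ᵐ[μ] fun x => (1 - t) * u x + t * v x := by
  filter_upwards [Lp.coeFn_add u (t • (v - u)), Lp.coeFn_smul t (v - u), Lp.coeFn_sub v u]
    with x h1 h2 h3
  rw [h1, Pi.add_apply, h2, Pi.smul_apply, h3, Pi.sub_apply, smul_eq_mul]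
  ring

theorem convexComb_mem_boundedLp {M : ℝ} {u v : Lp ℝ 2 μ} (hu : u ∈ boundedLp μ M)
    (hv : v ∈ boundedLp μ M) {t : ℝ} (ht0 : 0 ≤ t) (ht1 : t ≤ 1) :
    u + t • (v - u) ∈ boundedLp μ M := by
  have hu' : ∀ᵐ x ∂μ, |u x| ≤ M := hu
  have hv' : ∀ᵐ x ∂μ, |v x| ≤ M := hv
  have : ∀ᵐ x ∂μ, |(u + t • (v - u) : Lp ℝ 2 μ) x| ≤ M := by
    filter_upwards [hu', hv', coeFn_convexComb u v t] with x h1 h2 h3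
    rw [h3, abs_le]
    have h1' := abs_le.1 h1
    have h2' := abs_le.1 h2
    constructor <;> nlinarith
  exact this

variable [IsFiniteMeasure μ]

theorem integrable_comp_of_mem_boundedLp {j : ℝ → ℝ} (hj : Continuous j) {M : ℝ} {u : Lp ℝ 2 μ}
    (hu : u ∈ boundedLp μ M) : Integrable (fun x => j (u x)) μ := by
  obtain ⟨B, hB⟩ := exists_bound_comp hj M
  exact Integrable.of_bound (hj.comp_aestronglyMeasurable (Lp.aestronglyMeasurable u)) B
    ((show ∀ᵐ x ∂μ, |u x| ≤ M from hu).mono fun x hx => hB _ hx)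

theorem integral_convexComb_le {j : ℝ → ℝ} (hconv : ConvexOn ℝ univ j) (hj : Continuous j) {M : ℝ}
    {u v : Lp ℝ 2 μ} (hu : u ∈ boundedLp μ M) (hv : v ∈ boundedLp μ M) {t : ℝ} (ht0 : 0 ≤ t)
    (ht1 : t ≤ 1) :
    ∫ x, j ((u + t • (v - u) : Lp ℝ 2 μ) x) ∂μ
      ≤ (1 - t) * (∫ x, j (u x) ∂μ) + t * ∫ x, j (v x) ∂μ := by
  have hui := integrable_comp_of_mem_boundedLp hj hu
  have hvi := integrable_comp_of_mem_boundedLp hj hv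
  rw [← integral_const_mul, ← integral_const_mul,
    ← integral_add (hui.const_mul _) (hvi.const_mul _)]
  refine integral_mono_ae
    (integrable_comp_of_mem_boundedLp hj (convexComb_mem_boundedLp hu hv ht0 ht1))
    ((hui.const_mul _).add (hvi.const_mul _)) ?_
  filter_upwards [coeFn_convexComb u v t] with x hx
  rw [hx]
  exact hconv.2 (mem_univ _) (mem_univ _) (by linarith) ht0 (by ring)

/-- Expansion of the regularised functional along a segment. -/
theorem regEnergy_convexComb_le {j : ℝ → ℝ} (hconv : ConvexOn ℝ univ j) (hj : Continuous j)
    (T : Lp ℝ 2 μ →L[ℝ] E) (e : E) (δ : ℝ) {M : ℝ}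
    {u v : Lp ℝ 2 μ} (hu : u ∈ boundedLp μ M) (hv : v ∈ boundedLp μ M) {t : ℝ} (ht0 : 0 ≤ t)
    (ht1 : t ≤ 1) :
    regEnergy j T e δ (u + t • (v - u)) ≤ regEnergy j T e δ u
      + t * ((∫ x, j (v x) ∂μ) - (∫ x, j (u x) ∂μ) + δ * ⟪u, v - u⟫ + ⟪T u - e, T (v - u)⟫)
      + t ^ 2 * (δ / 2 * ‖v - u‖ ^ 2 + 1 / 2 * ‖T (v - u)‖ ^ 2) := by
  have h1 := integral_convexComb_le hconv hj hu hv ht0 ht1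
  have h2 : ‖u + t • (v - u)‖ ^ 2 = ‖u‖ ^ 2 + 2 * (t * ⟪u, v - u⟫) + t ^ 2 * ‖v - u‖ ^ 2 := by
    rw [norm_add_sq_real, real_inner_smul_right, norm_smul, mul_pow, Real.norm_eq_abs, sq_abs]
  have h3 : ‖T (u + t • (v - u)) - e‖ ^ 2
      = ‖T u - e‖ ^ 2 + 2 * (t * ⟪T u - e, T (v - u)⟫) + t ^ 2 * ‖T (v - u)‖ ^ 2 := by
    rw [map_add, map_smul, add_sub_right_comm, norm_add_sq_real, real_inner_smul_right, norm_smul,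
      mul_pow, Real.norm_eq_abs, sq_abs]
  simp only [regEnergy]
  rw [h2, h3]
  linarith

/-- The parallelogram identity for both quadratic terms. The gain in `‖v - u‖²` yields existence of
minimisers for fixed `δ > 0`; the gain in `‖T (v - u)‖²` does not depend on `δ` and drives the limit
`δ → 0`. -/
theorem regEnergy_midpoint_le {j : ℝ → ℝ} (hconv : ConvexOn ℝ univ j) (hj : Continuous j)
    (T : Lp ℝ 2 μ →L[ℝ] E) (e : E) (δ : ℝ) {M : ℝ}
    {u v : Lp ℝ 2 μ} (hu : u ∈ boundedLp μ M) (hv : v ∈ boundedLp μ M) :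
    regEnergy j T e δ (u + (1 / 2 : ℝ) • (v - u)) ≤
      1 / 2 * regEnergy j T e δ u + 1 / 2 * regEnergy j T e δ v
        - δ / 8 * ‖v - u‖ ^ 2 - 1 / 8 * ‖T (v - u)‖ ^ 2 := by
  have h1 := regEnergy_convexComb_le hconv hj T e δ hu hv (t := 1 / 2) (by norm_num) (by norm_num)
  have h2 : ‖v‖ ^ 2 = ‖u‖ ^ 2 + 2 * ⟪u, v - u⟫ + ‖v - u‖ ^ 2 := by
    rw [← norm_add_sq_real, add_sub_cancel]
  have h3 : ‖T v - e‖ ^ 2 = ‖T u - e‖ ^ 2 + 2 * ⟪T u - e, T (v - u)⟫ + ‖T (v - u)‖ ^ 2 := by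
    rw [← norm_add_sq_real, map_sub]
    congr 2; abel
  refine h1.trans (le_of_eq ?_)
  simp only [regEnergy]
  rw [h2, h3]
  ring

/-- The regularised functional attains its minimum on the functions bounded by `M`. -/
theorem exists_minimizer_regEnergy {j : ℝ → ℝ} (hconv : ConvexOn ℝ univ j) (hj : Continuous j)
    {C : ℝ} (hC : ∀ r, -C ≤ j r) (T : Lp ℝ 2 μ →L[ℝ] E) (e : E) {δ : ℝ} (hδ : 0 < δ) {M : ℝ}
    (hM : 0 ≤ M) :
    ∃ u ∈ boundedLp μ M, ∀ v ∈ boundedLp μ M, regEnergy j T e δ u ≤ regEnergy j T e δ v := by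
  have hmidpt : ∀ u v : Lp ℝ 2 μ, (1 / 2 : ℝ) • (u + v) = u + (1 / 2 : ℝ) • (v - u) := by
    intro u v; module
  refine exists_forall_le_of_midpoint (b := ∫ _, -C ∂μ) (c := δ / 8) ⟨0, ?_⟩ (isClosed_boundedLp M)
    (by positivity) (fun u hu => ?_) (fun u hu v hv => ?_) (fun u hu v hv => ?_)
    (fun u v hu huv => ?_)
  · have : ∀ᵐ x ∂μ, |(0 : Lp ℝ 2 μ) x| ≤ M := by
      filter_upwards [Lp.coeFn_zero ℝ 2 μ] with x hx
      rw [hx]; simpa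
    exact this
  · have h1 : ∫ _, -C ∂μ ≤ ∫ x, j (u x) ∂μ :=
      integral_mono (integrable_const _) (integrable_comp_of_mem_boundedLp hj hu) fun x => hC _
    have h2 : 0 ≤ δ / 2 * ‖u‖ ^ 2 := by positivity
    have h3 : 0 ≤ 1 / 2 * ‖T u - e‖ ^ 2 := by positivity
    rw [regEnergy]; linarith
  · rw [hmidpt]; exact convexComb_mem_boundedLp hu hv (by norm_num) (by norm_num)
  · rw [hmidpt, norm_sub_rev]
    have h1 := regEnergy_midpoint_le hconv hj T e δ hu hv
    have h2 : 0 ≤ 1 / 8 * ‖T (v - u)‖ ^ 2 := by positivity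
    linarith
  · obtain ⟨ns, hns, hae⟩ := (tendstoInMeasure_of_tendsto_Lp huv).exists_seq_tendsto_ae
    refine ⟨ns, hns, ?_⟩
    have huv' : Tendsto (fun k => u (ns k)) atTop (𝓝 v) := huv.comp hns.tendsto_atTop
    obtain ⟨B, hB⟩ := exists_bound_comp hj M
    -- The pointwise bound `M` makes `j (u (ns k))` uniformly bounded, so the `j`-integral is
    -- continuous along the subsequence.
    have h1 : Tendsto (fun k => ∫ x, j (u (ns k) x) ∂μ) atTop (𝓝 (∫ x, j (v x) ∂μ)) := by
      refine tendsto_integral_filter_of_dominated_convergence (fun _ => B)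
        (Eventually.of_forall fun k => hj.comp_aestronglyMeasurable (Lp.aestronglyMeasurable _))
        (Eventually.of_forall fun k =>
          (show ∀ᵐ x ∂μ, |u (ns k) x| ≤ M from hu (ns k)).mono fun x hx => hB _ hx)
        (integrable_const _) ?_
      filter_upwards [hae] with x hx using (hj.tendsto _).comp hx
    exact (h1.add ((huv'.norm.pow 2).const_mul _)).add
      (((((T.continuous.tendsto v).comp huv').sub_const e).norm.pow 2).const_mul _)

/-- The images under `T` of a minimiser and of a competitor are close when their energies are. -/
theorem norm_sq_sub_le_of_minimizer {j : ℝ → ℝ} (hconv : ConvexOn ℝ univ j) (hj : Continuous j)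
    {T : Lp ℝ 2 μ →L[ℝ] E} {e : E} {δ : ℝ} (hδ : 0 ≤ δ) {M : ℝ} {u v : Lp ℝ 2 μ}
    (hu : u ∈ boundedLp μ M)
    (hmin : ∀ v ∈ boundedLp μ M, regEnergy j T e δ u ≤ regEnergy j T e δ v)
    (hv : v ∈ boundedLp μ M) :
    ‖T v - T u‖ ^ 2 ≤ 4 * (regEnergy j T e δ v - regEnergy j T e δ u) := by
  have h1 := regEnergy_midpoint_le hconv hj T e δ hu hv
  have h2 := hmin _ (convexComb_mem_boundedLp hu hv (t := 1 / 2) (by norm_num) (by norm_num))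
  have h3 : 0 ≤ δ / 8 * ‖v - u‖ ^ 2 := by positivity
  rw [← map_sub]
  linarith

/-- The variational inequality satisfied by a minimiser. -/
theorem variational_inequality_of_minimizer {j : ℝ → ℝ} (hconv : ConvexOn ℝ univ j)
    (hj : Continuous j) {T : Lp ℝ 2 μ →L[ℝ] E} {e : E} {δ : ℝ} {M : ℝ} {u v : Lp ℝ 2 μ}
    (hu : u ∈ boundedLp μ M)
    (hmin : ∀ v ∈ boundedLp μ M, regEnergy j T e δ u ≤ regEnergy j T e δ v)
    (hv : v ∈ boundedLp μ M) :
    0 ≤ (∫ x, j (v x) ∂μ) - (∫ x, j (u x) ∂μ) + δ * ⟪u, v - u⟫ + ⟪T u - e, T (v - u)⟫ := by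
  set A := (∫ x, j (v x) ∂μ) - (∫ x, j (u x) ∂μ) + δ * ⟪u, v - u⟫ + ⟪T u - e, T (v - u)⟫ with hA
  set B := δ / 2 * ‖v - u‖ ^ 2 + 1 / 2 * ‖T (v - u)‖ ^ 2 with hB
  -- Minimality along the segment gives `0 ≤ t (A + t B)`; divide by `t = 1 / (k + 1)` and let it
  -- tend to zero.
  have hlim : Tendsto (fun k : ℕ => A + 1 / ((k : ℝ) + 1) * B) atTop (𝓝 A) := by
    simpa using ((tendsto_one_div_add_atTop_nhds_zero_nat (𝕜 := ℝ)).mul_const B).const_add A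
  refine ge_of_tendsto' hlim fun k => ?_
  have ht : (0 : ℝ) < 1 / ((k : ℝ) + 1) := by positivity
  have ht1 : 1 / ((k : ℝ) + 1) ≤ 1 := by
    rw [div_le_one (by positivity)]; linarith [k.cast_nonneg (α := ℝ)]
  have h1 := regEnergy_convexComb_le hconv hj T e δ hu hv ht.le ht1
  have h2 := hmin _ (convexComb_mem_boundedLp hu hv ht.le ht1)
  rw [← hA, ← hB] at h1
  have h3 : 0 ≤ 1 / ((k : ℝ) + 1) * (A + 1 / ((k : ℝ) + 1) * B) := by linarith
  exact nonneg_of_mul_nonneg_right h3 ht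

/-- The pointwise Euler-Lagrange inequality satisfied by a minimiser. -/
theorem pointwise_inequality_of_minimizer {j : ℝ → ℝ} (hconv : ConvexOn ℝ univ j)
    (hj : Continuous j) {T : Lp ℝ 2 μ →L[ℝ] E} {e : E} {δ : ℝ} {M : ℝ} {u g : Lp ℝ 2 μ}
    (hu : u ∈ boundedLp μ M)
    (hmin : ∀ v ∈ boundedLp μ M, regEnergy j T e δ u ≤ regEnergy j T e δ v)
    (hg : ∀ h, ⟪T u - e, T h⟫ = ⟪g, h⟫) {s : ℝ} (hs : |s| ≤ M) :
    ∀ᵐ x ∂μ, 0 ≤ j s - j (u x) + (δ * u x + g x) * (s - u x) := by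
  have hui := integrable_comp_of_mem_boundedLp hj hu
  have hu' : ∀ᵐ x ∂μ, |u x| ≤ M := hu
  have hint2 : Integrable (fun x => (δ * u x + g x) * (s - u x)) μ := by
    refine integrable_mul_of_ae_bound (B := 2 * M) ?_
      (aestronglyMeasurable_const.sub (Lp.aestronglyMeasurable u)) ?_
    · exact ((((Lp.memLp u).integrable (by norm_num)).const_mul δ)).add
        ((Lp.memLp g).integrable (by norm_num))
    · filter_upwards [hu'] with x hx
      exact (abs_sub _ _).trans (by linarith)
  have hint1 : Integrable (fun x => j s - j (u x)) μ := (integrable_const _).sub hui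
  -- The inequality is localised by the competitor equal to `s` on `S` and to `u` elsewhere, which
  -- is still bounded by `M`.
  refine ae_nonneg_of_forall_setIntegral_nonneg (hint1.add hint2) fun S hS _ => ?_
  classical
  have hvm : AEStronglyMeasurable (S.piecewise (fun _ => s) u) μ :=
    (aestronglyMeasurable_const.piecewise hS
      (Lp.aestronglyMeasurable u).restrict)
  have hvb : ∀ᵐ x ∂μ, |S.piecewise (fun _ => s) u x| ≤ M := by
    filter_upwards [hu'] with x hx
    by_cases h : x ∈ S <;> simp [h, hs, hx]
  have hv2 : MemLp (S.piecewise (fun _ => s) u) 2 μ := MemLp.of_bound hvm M hvb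
  have hvK : hv2.toLp _ ∈ boundedLp μ M := by
    have : ∀ᵐ x ∂μ, |hv2.toLp _ x| ≤ M := by
      filter_upwards [hvb, hv2.coeFn_toLp] with x h1 h2
      rwa [h2]
    exact this
  have key := variational_inequality_of_minimizer hconv hj hu hmin hvK
  rw [hg, ← real_inner_smul_left, add_assoc, ← inner_add_left, L2.inner_def,
    ← integral_sub (integrable_comp_of_mem_boundedLp hj hvK) hui] at key
  have e1 : ∫ x, (j (hv2.toLp _ x) - j (u x)) ∂μ = ∫ x in S, (j s - j (u x)) ∂μ := by
    rw [← integral_indicator hS]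
    refine integral_congr_ae ?_
    filter_upwards [hv2.coeFn_toLp] with x hx
    rw [hx]
    by_cases h : x ∈ S <;> simp [h]
  have e2 : ∫ x, ⟪(δ • u + g : Lp ℝ 2 μ) x, (hv2.toLp _ - u : Lp ℝ 2 μ) x⟫ ∂μ
      = ∫ x in S, (δ * u x + g x) * (s - u x) ∂μ := by
    rw [← integral_indicator hS]
    refine integral_congr_ae ?_
    filter_upwards [hv2.coeFn_toLp, Lp.coeFn_add (δ • u) g, Lp.coeFn_smul δ u,
      Lp.coeFn_sub (hv2.toLp _) u] with x h1 h2 h3 h4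
    rw [h2, Pi.add_apply, h3, h4, Pi.sub_apply, h1]
    by_cases h : x ∈ S <;> simp [h, mul_comm]
  rw [e1, e2] at key
  rwa [integral_add hint1.restrict hint2.restrict]

end Regularised

/-! ### Passage to the limit in the subdifferential inclusion -/

section Limit

variable {α : Type*} [MeasurableSpace α] {μ : Measure α} [IsFiniteMeasure μ]

/-- De la Vallée-Poussin's criterion: a bound on `∫ j(u n)`, with `j` superlinear, gives uniform
integrability. -/
theorem exists_integral_abs_sub_truncate_le {ι : Type*} {j : ℝ → ℝ}
    (hsuper : Tendsto (fun r : ℝ => j r / |r|) (cocompact ℝ) atTop) {C : ℝ} (hC0 : 0 ≤ C)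
    (hC : ∀ r, -C ≤ j r) {u : ι → α → ℝ} (hju : ∀ n, Integrable (fun x => j (u n x)) μ) {B : ℝ}
    (hB : ∀ n, ∫ x, j (u n x) ∂μ ≤ B) {ε : ℝ} (hε : 0 < ε) :
    ∃ M > 0, ∀ n, ∫ x, |u n x - truncate M (u n x)| ∂μ ≤ ε := by
  -- `D` dominates every `∫ (j (u n) + C)`, and the added `1` keeps it positive. Below height `M`
  -- the truncation error vanishes; above it, superlinearity bounds `|u n|` by `ε / D * (j (u n) +
  -- C)`.
  set D := |B| + C * μ.real univ + 1 with hD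
  have hDpos : 0 < D := by positivity
  obtain ⟨M, hM, hMj⟩ := exists_abs_le_mul_of_superlinear hsuper hC0 (div_pos hε hDpos)
  refine ⟨M, hM, fun n => ?_⟩
  have hi : Integrable (fun x => j (u n x) + C) μ := (hju n).add (integrable_const C)
  calc ∫ x, |u n x - truncate M (u n x)| ∂μ ≤ ∫ x, ε / D * (j (u n x) + C) ∂μ := by
        refine integral_mono_of_nonneg (Eventually.of_forall fun x => abs_nonneg _)
          (hi.const_mul _) (Eventually.of_forall fun x => ?_)
        rcases le_total M |u n x| with h | h
        · exact (abs_sub_truncate_le hM.le _).trans (hMj _ h)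
        · have h1 : 0 ≤ j (u n x) + C := by linarith [hC (u n x)]
          have h2 : |u n x - truncate M (u n x)| = 0 := by
            rw [truncate_eq_self h, sub_self, abs_zero]
          show |u n x - truncate M (u n x)| ≤ _
          rw [h2]; positivity
    _ = ε / D * (∫ x, j (u n x) ∂μ + C * μ.real univ) := by
        rw [integral_const_mul, integral_add (hju n) (integrable_const C), integral_const,
          smul_eq_mul, mul_comm C]
    _ ≤ ε / D * D := by
        refine mul_le_mul_of_nonneg_left ?_ (by positivity)
        linarith [hB n, le_abs_self B]
    _ = ε := div_mul_cancel₀ ε hDpos.ne'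

/-- Uniform integrability on a finite measure space bounds the `L¹` norms, as `|u| ≤ M + |u -
truncate M u|` at the height for `ε = 1`. The bound absorbs the errors in
`affine_inequality_of_weak_limit`. -/
theorem exists_integral_abs_le {ι : Type*} {u : ι → α → ℝ} (hu : ∀ n, Integrable (u n) μ)
    (hUI : ∀ ε > 0, ∃ M > 0, ∀ n, ∫ x, |u n x - truncate M (u n x)| ∂μ ≤ ε) :
    ∃ B, ∀ n, ∫ x, |u n x| ∂μ ≤ B := by
  obtain ⟨M, hM, h⟩ := hUI 1 one_pos
  refine ⟨M * μ.real univ + 1, fun n => ?_⟩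
  have hi : Integrable (fun x => |u n x - truncate M (u n x)|) μ :=
    ((hu n).sub (Integrable.of_bound ((continuous_truncate M).comp_aestronglyMeasurable
      (hu n).aestronglyMeasurable) M
      (Eventually.of_forall fun x => abs_truncate_le hM.le (u n x)))).abs
  calc ∫ x, |u n x| ∂μ ≤ ∫ x, (M + |u n x - truncate M (u n x)|) ∂μ := by
        refine integral_mono (hu n).abs ((integrable_const M).add hi) fun x => ?_
        have h1 := abs_truncate_le hM.le (u n x)
        have h2 := abs_add_le (truncate M (u n x)) (u n x - truncate M (u n x))
        rw [add_sub_cancel] at h2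
        show |u n x| ≤ M + |u n x - truncate M (u n x)|
        linarith
    _ ≤ M * μ.real univ + 1 := by
        rw [integral_add (integrable_const M) hi, integral_const, smul_eq_mul, mul_comm M]
        linarith [h n]

/-- On a set where `w k → w` uniformly and `w` is bounded, approximate inequalities which are affine
in `u k` pass to the weak limit. -/
theorem affine_inequality_of_weak_limit {U : Filter ℕ} [NeBot U] (hU : U ≤ atTop)
    {u : ℕ → α → ℝ} {v : α → ℝ} (hu : ∀ n, Integrable (u n) μ) (hv : Integrable v μ)
    (hlim : ∀ (φ : α → ℝ) (B : ℝ), AEStronglyMeasurable φ μ → (∀ᵐ x ∂μ, |φ x| ≤ B) →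
      Tendsto (fun n => ∫ x, u n x * φ x ∂μ) U (𝓝 (∫ x, v x * φ x ∂μ)))
    {B : ℝ} (hB : ∀ n, ∫ x, |u n x| ∂μ ≤ B)
    {w : ℕ → α → ℝ} {w₀ : α → ℝ} (hw₀ : AEStronglyMeasurable w₀ μ) {S : Set α}
    (hS : MeasurableSet S) (hunif : TendstoUniformlyOn w w₀ atTop S) {M : ℝ}
    (hM : ∀ x ∈ S, |w₀ x| ≤ M) {δ : ℕ → ℝ} (hδ0 : ∀ n, 0 ≤ δ n) (hδ : Tendsto δ atTop (𝓝 0))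
    {p c s b : ℝ} (hineq : ∀ᶠ n in atTop, ∀ᵐ x ∂μ,
      p * u n x + c ≤ b + (δ n * u n x + w n x) * (s - u n x)) :
    ∀ᵐ x ∂μ, x ∈ S → p * v x + c ≤ b + w₀ x * (s - v x) := by
  have hSw : ∀ᵐ x ∂(μ.restrict S), |w₀ x| ≤ M :=
    (ae_restrict_iff' hS).2 (Eventually.of_forall hM)
  have hw₀i : Integrable w₀ (μ.restrict S) :=
    Integrable.of_bound hw₀.restrict M hSw
  have hpw : Integrable (fun x => v x * (p + w₀ x)) (μ.restrict S) :=
    integrable_mul_of_ae_bound hv.restrict (aestronglyMeasurable_const.add hw₀.restrict)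
      (B := |p| + M) (hSw.mono fun x hx => (abs_add_le _ _).trans (by linarith))
  have hconst : Integrable (fun x => b - c + w₀ x * s) (μ.restrict S) :=
    (integrable_const _).add (hw₀i.mul_const s)
  have hae : 0 ≤ᵐ[μ.restrict S] fun x => (b - c + w₀ x * s) - v x * (p + w₀ x) := by
    refine ae_nonneg_of_forall_setIntegral_nonneg (hconst.sub hpw) fun A hA _ => ?_
    rw [Measure.restrict_restrict hA]
    have hmeas : MeasurableSet (A ∩ S) := hA.inter hS
    have hle : μ.restrict (A ∩ S) ≤ μ.restrict S := Measure.restrict_mono inter_subset_right le_rfl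
    have hpw' := hpw.mono_measure hle
    have hconst' := hconst.mono_measure hle
    rw [integral_sub hconst' hpw', sub_nonneg]
    -- Gathering the terms linear in `u n` leaves `u n * (p + w₀)`; since `w₀` is bounded on `S`,
    -- this coefficient is a legitimate test function for weak `L¹` convergence.
    set φ : α → ℝ := (A ∩ S).indicator fun x => p + w₀ x with hφ
    have hφm : AEStronglyMeasurable φ μ :=
      (aestronglyMeasurable_const.add hw₀).indicator hmeas
    have hMp : ∀ x, |φ x| ≤ |p| + |M| := fun x => by
      by_cases hx : x ∈ A ∩ S
      · rw [hφ, indicator_of_mem hx]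
        exact (abs_add_le _ _).trans (by linarith [hM x hx.2, le_abs_self M])
      · rw [hφ, indicator_of_notMem hx, abs_zero]; positivity
    have hφint : ∀ g : α → ℝ, ∫ x, g x * φ x ∂μ = ∫ x in A ∩ S, g x * (p + w₀ x) ∂μ := by
      intro g
      rw [← integral_indicator hmeas]
      refine integral_congr_ae (Eventually.of_forall fun x => ?_)
      by_cases hx : x ∈ A ∩ S <;> simp [hφ, hx]
    have hlim' := hlim φ _ hφm (Eventually.of_forall hMp)
    simp only [hφint] at hlim'
    -- Bounds the integral of `|s| + (1 + |s|) |u n|`, which collects the errors from replacing `w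
    -- n` by `w₀` and from the `δ n` term.
    set D := |s| * μ.real univ + (1 + |s|) * B with hD
    have hτ : ∀ τ > 0, ∫ x in A ∩ S, v x * (p + w₀ x) ∂μ
        ≤ (∫ x in A ∩ S, (b - c + w₀ x * s) ∂μ) + τ * D := by
      intro τ hτ
      refine le_of_tendsto hlim' (hU ?_)
      filter_upwards [hineq, Metric.tendstoUniformlyOn_iff.1 hunif τ hτ,
        hδ.eventually (gt_mem_nhds hτ)] with n h1 h2 h3
      have hi1 : Integrable (fun x => u n x * (p + w₀ x)) (μ.restrict (A ∩ S)) :=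
        integrable_mul_of_ae_bound (hu n).restrict
          (aestronglyMeasurable_const.add hw₀.restrict) (B := |p| + M)
          ((hSw.filter_mono (ae_mono hle)).mono fun x hx => (abs_add_le _ _).trans (by linarith))
      have hi2 : Integrable (fun x => τ * (|s| + (1 + |s|) * |u n x|)) μ :=
        (((integrable_const _).add ((hu n).abs.const_mul _)).const_mul _)
      have hpt : ∀ᵐ x ∂(μ.restrict (A ∩ S)), u n x * (p + w₀ x)
          ≤ (b - c + w₀ x * s) + τ * (|s| + (1 + |s|) * |u n x|) := by
        rw [ae_restrict_iff' hmeas]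
        filter_upwards [h1] with x hx hxS
        have h4 : |w n x - w₀ x| ≤ τ := by
          have := h2 x hxS.2
          rw [dist_comm, Real.dist_eq] at this
          exact this.le
        have h5 : (w n x - w₀ x) * (s - u n x) ≤ τ * (|s| + |u n x|) := by
          refine (le_abs_self _).trans ?_
          -- Uniform closeness of `w n` to `w₀` is indispensable here: it multiplies `s - u n`,
          -- which is bounded only in `L¹`.
          rw [abs_mul]
          exact mul_le_mul h4 (abs_sub _ _) (abs_nonneg _) hτ.le
        -- The quadratic part `-δ n (u n)²` has the favourable sign and is dropped, so no `L²` bound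
        -- on `u n` is needed.
        have h6 : δ n * u n x * (s - u n x) ≤ τ * (|s| * |u n x|) := by
          have h7 : u n x * s ≤ |s| * |u n x| := by
            rw [mul_comm, ← abs_mul]; exact le_abs_self _
          have h8 : δ n * (u n x * s) ≤ τ * (|s| * |u n x|) :=
            (mul_le_mul_of_nonneg_left h7 (hδ0 n)).trans
              (mul_le_mul_of_nonneg_right h3.le (by positivity))
          nlinarith [mul_nonneg (hδ0 n) (sq_nonneg (u n x))]
        nlinarith
      calc ∫ x in A ∩ S, u n x * (p + w₀ x) ∂μ
          ≤ ∫ x in A ∩ S, ((b - c + w₀ x * s) + τ * (|s| + (1 + |s|) * |u n x|)) ∂μ :=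
            integral_mono_ae hi1 (hconst'.add hi2.restrict) hpt
        _ = (∫ x in A ∩ S, (b - c + w₀ x * s) ∂μ)
            + ∫ x in A ∩ S, τ * (|s| + (1 + |s|) * |u n x|) ∂μ :=
            integral_add hconst' hi2.restrict
        _ ≤ (∫ x in A ∩ S, (b - c + w₀ x * s) ∂μ) + τ * D := by
            refine add_le_add le_rfl ?_
            refine (setIntegral_le_integral hi2
              (Eventually.of_forall fun x => by dsimp; positivity)).trans ?_
            rw [integral_const_mul, integral_add (integrable_const _) ((hu n).abs.const_mul _),
              integral_const_mul, integral_const, smul_eq_mul, mul_comm (μ.real univ)]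
            refine mul_le_mul_of_nonneg_left ?_ hτ.le
            linarith [mul_le_mul_of_nonneg_left (hB n) (by positivity : 0 ≤ 1 + |s|)]
    have hτlim : Tendsto (fun k : ℕ => (∫ x in A ∩ S, (b - c + w₀ x * s) ∂μ)
        + 1 / ((k : ℝ) + 1) * D) atTop (𝓝 (∫ x in A ∩ S, (b - c + w₀ x * s) ∂μ)) := by
      simpa using ((tendsto_one_div_add_atTop_nhds_zero_nat (𝕜 := ℝ)).mul_const D).const_add
        (∫ x in A ∩ S, (b - c + w₀ x * s) ∂μ)
    exact ge_of_tendsto' hτlim fun k => hτ _ (by positivity)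
  filter_upwards [(ae_restrict_iff' hS).1 hae] with x hx hxS
  have := hx hxS
  simp only [Pi.zero_apply] at this
  linarith

/-- Closedness of the subdifferential: the second variable converges almost everywhere, the first
one weakly in `L¹`. -/
theorem subgradient_of_weak_limit {j : ℝ → ℝ} (hconv : ConvexOn ℝ univ j) (hj : Continuous j)
    {U : Filter ℕ} [NeBot U] (hU : U ≤ atTop)
    {u : ℕ → α → ℝ} {v : α → ℝ} (hu : ∀ n, Integrable (u n) μ) (hv : Integrable v μ)
    (hlim : ∀ (φ : α → ℝ) (B : ℝ), AEStronglyMeasurable φ μ → (∀ᵐ x ∂μ, |φ x| ≤ B) →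
      Tendsto (fun n => ∫ x, u n x * φ x ∂μ) U (𝓝 (∫ x, v x * φ x ∂μ)))
    {B : ℝ} (hB : ∀ n, ∫ x, |u n x| ∂μ ≤ B)
    {w : ℕ → α → ℝ} {w₀ : α → ℝ} (hw : ∀ n, StronglyMeasurable (w n))
    (hw₀ : StronglyMeasurable w₀)
    (hwlim : ∀ᵐ x ∂μ, Tendsto (fun n => w n x) atTop (𝓝 (w₀ x)))
    {δ : ℕ → ℝ} (hδ0 : ∀ n, 0 ≤ δ n) (hδ : Tendsto δ atTop (𝓝 0))
    (hineq : ∀ s : ℝ, ∀ᶠ n in atTop, ∀ᵐ x ∂μ,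
      j (u n x) ≤ j s + (δ n * u n x + w n x) * (s - u n x)) :
    ∀ᵐ x ∂μ, ∀ s, j (v x) ≤ j s + w₀ x * (s - v x) := by
  -- Weak convergence does not commute with `j`, but it does with each affine minorant; countability
  -- lets the exceptional null sets be united.
  obtain ⟨p, c, hpc, hsup⟩ := exists_countable_affine hconv hj.lowerSemicontinuous
  have hpos : ∀ m : ℕ, (0 : ℝ) < 1 / ((m : ℝ) + 1) := fun m => by positivity
  -- Egorov: off sets `t m` of measure at most `1 / (m + 1)` the convergence of `w n` is uniform,
  -- and almost every point avoids some `t m`.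
  choose t htm htμ htunif using fun m => tendstoUniformlyOn_of_ae_tendsto' hw hw₀ hwlim (hpos m)
  have hcover : ∀ᵐ x ∂μ, ∃ m, x ∉ t m := by
    rw [ae_iff]
    have hset : {x | ¬ ∃ m, x ∉ t m} = ⋂ m, t m := by ext x; simp
    rw [hset]
    refine le_antisymm (ge_of_tendsto' (x := atTop) (f := fun m : ℕ =>
      ENNReal.ofReal (1 / ((m : ℝ) + 1))) ?_ fun m =>
        (measure_mono (iInter_subset t m)).trans (htμ m)) zero_le
    have := (ENNReal.continuous_ofReal.tendsto 0).comp
      (tendsto_one_div_add_atTop_nhds_zero_nat (𝕜 := ℝ))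
    rwa [ENNReal.ofReal_zero] at this
  have hloc : ∀ (i : ℕ) (s : ℚ) (m k : ℕ), ∀ᵐ x ∂μ, x ∈ (t m)ᶜ ∩ {x | |w₀ x| ≤ k} →
      p i * v x + c i ≤ j s + w₀ x * (s - v x) := by
    intro i s m k
    refine affine_inequality_of_weak_limit hU hu hv hlim hB hw₀.aestronglyMeasurable
      ((htm m).compl.inter (measurableSet_le hw₀.measurable.abs measurable_const))
      ((htunif m).mono inter_subset_left) (fun x hx => hx.2) hδ0 hδ ?_
    filter_upwards [hineq s] with n hn
    filter_upwards [hn] with x hx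
    exact (hpc i _).trans hx
  simp only [← ae_all_iff] at hloc
  filter_upwards [hcover, hloc] with x ⟨m, hm⟩ hx
  obtain ⟨k, hk⟩ := exists_nat_ge |w₀ x|
  have hrat : ∀ s : ℚ, j (v x) ≤ j s + w₀ x * (s - v x) := fun s =>
    hsup _ _ fun i => hx i s m k ⟨hm, hk⟩
  intro s
  -- Only rational `s` were treated, to keep the null sets countable; continuity of `j` gives the
  -- others.
  have hclosed : IsClosed {s : ℝ | j (v x) ≤ j s + w₀ x * (s - v x)} :=
    isClosed_le continuous_const (by fun_prop)
  have := hclosed.closure_subset_iff.2 (show range ((↑) : ℚ → ℝ) ⊆ _ from by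
    rintro _ ⟨q, rfl⟩; exact hrat q)
  exact this (Rat.denseRange_cast s)

end Limit

namespace ImageRestoration

variable {d : ℕ} {Ω : Opens (Rd d)}

/-! ### The Dirichlet problem -/

/-- The map from an element of `H¹₀(Ω)` to its function, as a continuous linear map. -/
noncomputable def H10.fnL (Ω : Opens (Rd d)) : H10 Ω →L[ℝ] Lp ℝ 2 (vol Ω) :=
  (WithLp.fstL 2 ℝ _ _).comp (H10 Ω).subtypeL

/-- The map from an element of `H¹₀(Ω)` to its gradient, as a continuous linear map. -/
noncomputable def H10.gradL (Ω : Opens (Rd d)) : H10 Ω →L[ℝ] Lp (Rd d) 2 (vol Ω) :=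
  (WithLp.sndL 2 ℝ _ _).comp (H10 Ω).subtypeL

theorem dirichlet_eq_inner (w φ : H10 Ω) : dirichlet w φ = ⟪H10.grad w, H10.grad φ⟫ := rfl

theorem dirichlet_add_left (w z φ : H10 Ω) :
    dirichlet (w + z) φ = dirichlet w φ + dirichlet z φ :=
  inner_add_left (H10.grad w) (H10.grad z) (H10.grad φ)

theorem dirichlet_smul_left (r : ℝ) (w φ : H10 Ω) : dirichlet (r • w) φ = r * dirichlet w φ :=
  real_inner_smul_left (H10.grad w) (H10.grad φ) r

/-- The functional `φ ↦ ∫_Ω ∇w ⬝ ∇φ`. -/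
noncomputable def dirichletForm (w : H10 Ω) : Hm1 Ω :=
  (innerSL ℝ (H10.grad w)).comp (H10.gradL Ω)

theorem dirichletForm_apply (w φ : H10 Ω) : dirichletForm w φ = dirichlet w φ := rfl

/-- The embedding of `L²(Ω)` into `H⁻¹(Ω)`. -/
noncomputable def L2ToHm1 (Ω : Opens (Rd d)) : Lp ℝ 2 (vol Ω) →L[ℝ] Hm1 Ω :=
  (innerSL ℝ).bilinearComp (ContinuousLinearMap.id ℝ _) (H10.fnL Ω)

theorem L2ToHm1_apply (u : Lp ℝ 2 (vol Ω)) (φ : H10 Ω) : L2ToHm1 Ω u φ = ⟪u, H10.fn φ⟫ := rfl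

/-- By Poincaré's inequality the gradient alone controls the full norm. The constant there has no
declared sign, hence `|C| + 1`. -/
theorem exists_norm_sq_le_grad [NeZero d] (hΩ : Bornology.IsBounded (Ω : Set (Rd d))) :
    ∃ C : ℝ, 0 < C ∧ ∀ w : H10 Ω, ‖w‖ ^ 2 ≤ C * ‖H10.grad w‖ ^ 2 := by
  obtain ⟨C, hC⟩ := poincare hΩ
  refine ⟨|C| + 1, by positivity, fun w => ?_⟩
  have hnorm : ‖w‖ ^ 2 = ‖H10.fn w‖ ^ 2 + ‖H10.grad w‖ ^ 2 :=
    WithLp.prod_norm_sq_eq_of_L2 (w : L2Pair Ω)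
  rw [hnorm]
  nlinarith [hC w, le_abs_self C, sq_nonneg ‖H10.grad w‖]

theorem completeSpace_H10 (Ω : Opens (Rd d)) : CompleteSpace (H10 Ω) :=
  (Submodule.isClosed_topologicalClosure _).completeSpace_coe

theorem isDirichletSolution_invNegLaplacian [NeZero d]
    (hΩ : Bornology.IsBounded (Ω : Set (Rd d))) (F : Hm1 Ω) :
    IsDirichletSolution F (invNegLaplacian F) :=
  Classical.epsilon_spec (existsUnique_isDirichletSolution hΩ F).exists

theorem invNegLaplacian_eq [NeZero d] (hΩ : Bornology.IsBounded (Ω : Set (Rd d))) {F : Hm1 Ω}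
    {w : H10 Ω} (hw : IsDirichletSolution F w) : invNegLaplacian F = w :=
  (existsUnique_isDirichletSolution hΩ F).unique (isDirichletSolution_invNegLaplacian hΩ F) hw

/-- Uniqueness for the Dirichlet problem makes the chosen solution inherit linearity from the
equation. -/
theorem isLinearMap_invNegLaplacian [NeZero d] (hΩ : Bornology.IsBounded (Ω : Set (Rd d))) :
    IsLinearMap ℝ (invNegLaplacian : Hm1 Ω → H10 Ω) where
  map_add F G := by
    refine invNegLaplacian_eq hΩ fun φ => ?_
    rw [dirichlet_add_left, isDirichletSolution_invNegLaplacian hΩ F φ,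
      isDirichletSolution_invNegLaplacian hΩ G φ, _root_.add_apply]
  map_smul r F := by
    refine invNegLaplacian_eq hΩ fun φ => ?_
    rw [dirichlet_smul_left, isDirichletSolution_invNegLaplacian hΩ F φ, _root_.smul_apply,
      smul_eq_mul]

/-- Test the equation for `w` with `w` itself, use Poincaré's inequality and divide by `‖w‖`. -/
theorem exists_norm_invNegLaplacian_le [NeZero d] (hΩ : Bornology.IsBounded (Ω : Set (Rd d))) :
    ∃ C : ℝ, ∀ F : Hm1 Ω, ‖invNegLaplacian F‖ ≤ C * ‖F‖ := by
  obtain ⟨C, hC0, hC⟩ := exists_norm_sq_le_grad hΩ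
  refine ⟨C, fun F => ?_⟩
  set w := invNegLaplacian F with hw
  have h1 : ‖w‖ ^ 2 ≤ C * (‖F‖ * ‖w‖) := by
    refine (hC w).trans (mul_le_mul_of_nonneg_left ?_ hC0.le)
    rw [← real_inner_self_eq_norm_sq, ← dirichlet_eq_inner,
      isDirichletSolution_invNegLaplacian hΩ F w]
    exact (le_abs_self _).trans (F.le_opNorm w)
  rcases (norm_nonneg w).eq_or_lt with h0 | h0
  · rw [← h0]; positivity
  · refine le_of_mul_le_mul_right ?_ h0
    linarith

/-- The solution operator of the Dirichlet problem is linear and continuous. -/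
theorem exists_dirichlet_solution_operator [NeZero d]
    (hΩ : Bornology.IsBounded (Ω : Set (Rd d))) :
    ∃ R : Hm1 Ω →L[ℝ] H10 Ω, ∀ F, IsDirichletSolution F (R F) := by
  obtain ⟨C, hC⟩ := exists_norm_invNegLaplacian_le hΩ
  let L : Hm1 Ω →ₗ[ℝ] H10 Ω := IsLinearMap.mk' _ (isLinearMap_invNegLaplacian hΩ)
  have hL : Continuous L := AddMonoidHomClass.continuous_of_bound L C hC
  exact ⟨⟨L, hL⟩, isDirichletSolution_invNegLaplacian hΩ⟩

/-! ### Solutions of the regularised problems -/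

theorem isFiniteMeasure_vol (hΩ : Bornology.IsBounded (Ω : Set (Rd d))) :
    IsFiniteMeasure (vol Ω) :=
  ⟨by rw [Measure.restrict_apply_univ]; exact hΩ.measure_lt_top⟩

/-- Approximate solutions `(u n, w n)` of the Euler-Lagrange system, with `w n` converging strongly
in `H¹₀(Ω)` and almost everywhere. -/
theorem exists_approximate_solutions [NeZero d] (hΩ : Bornology.IsBounded (Ω : Set (Rd d)))
    (f : Hm1 Ω) {j : ℝ → ℝ} (hconv : ConvexOn ℝ univ j) (hj : Continuous j)
    {C : ℝ} (hC : ∀ r, -C ≤ j r) :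
    ∃ (u : ℕ → Lp ℝ 2 (vol Ω)) (w : ℕ → H10 Ω) (w₀ : H10 Ω) (δ : ℕ → ℝ) (B : ℝ),
      (∀ n φ, dirichlet (w n) φ = ⟪u n, H10.fn φ⟫ - f φ) ∧
      Tendsto w atTop (𝓝 w₀) ∧
      (∀ᵐ x ∂(vol Ω), Tendsto (fun n => H10.fn (w n) x) atTop (𝓝 (H10.fn w₀ x))) ∧
      (∀ n, 0 ≤ δ n) ∧ Tendsto δ atTop (𝓝 0) ∧
      (∀ n, Integrable (fun x => j (u n x)) (vol Ω)) ∧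
      (∀ n, ∫ x in (Ω : Set (Rd d)), j (u n x) ≤ B) ∧
      ∀ s : ℝ, ∀ᶠ n in atTop, ∀ᵐ x ∂(vol Ω),
        j (u n x) ≤ j s + (δ n * u n x + H10.fn (w n) x) * (s - u n x) := by
  have := isFiniteMeasure_vol hΩ
  have := completeSpace_H10 Ω
  obtain ⟨R, hR⟩ := exists_dirichlet_solution_operator hΩ
  obtain ⟨A, hA0, hA⟩ := exists_norm_sq_le_grad hΩ
  -- `T u = ∇(-Δ)⁻¹u` and `e = ∇(-Δ)⁻¹f`, so that `‖T u - e‖² = ‖u - f‖²₋₁`.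
  let T : Lp ℝ 2 (vol Ω) →L[ℝ] Lp (Rd d) 2 (vol Ω) := (H10.gradL Ω).comp (R.comp (L2ToHm1 Ω))
  let e : Lp (Rd d) 2 (vol Ω) := H10.grad (R f)
  set δ : ℕ → ℝ := fun n => 1 / ((n : ℝ) + 1) with hδ
  have hδpos : ∀ n, 0 < δ n := fun n => by simp only [hδ]; positivity
  have hδlim : Tendsto δ atTop (𝓝 0) := tendsto_one_div_add_atTop_nhds_zero_nat
  choose u huK humin using fun n : ℕ => exists_minimizer_regEnergy hconv hj hC T e (hδpos n)
    (n.cast_nonneg (α := ℝ))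
  have hmono : ∀ {m n : ℕ}, m ≤ n → u m ∈ boundedLp (vol Ω) n := fun {m n} hmn => by
    have h1 : ∀ᵐ x ∂(vol Ω), |u m x| ≤ m := huK m
    have h2 : ∀ᵐ x ∂(vol Ω), |u m x| ≤ n := h1.mono fun x hx =>
      hx.trans (Nat.cast_le.2 hmn)
    exact h2
  set E : ℕ → ℝ := fun n => regEnergy j T e (δ n) (u n) with hE
  have hEle : ∀ {m n : ℕ}, m ≤ n → regEnergy j T e (δ n) (u m) ≤ E m := fun {m n} hmn => by
    have h1 : δ n ≤ δ m := Nat.one_div_le_one_div hmn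
    simp only [hE, regEnergy]
    have := mul_le_mul_of_nonneg_right h1 (sq_nonneg ‖u m‖)
    linarith
  -- The constraint sets grow with `n` while `δ n` shrinks, so an earlier minimiser is a competitor
  -- of no larger energy at every later stage.
  have hEanti : Antitone E := fun m n hmn => (humin n _ (hmono hmn)).trans (hEle hmn)
  have hji : ∀ n, Integrable (fun x => j (u n x)) (vol Ω) := fun n =>
    integrable_comp_of_mem_boundedLp hj (huK n)
  have hjE : ∀ n, ∫ x in (Ω : Set (Rd d)), j (u n x) ≤ E n := fun n => by
    have h2 : 0 ≤ δ n / 2 * ‖u n‖ ^ 2 := by have := hδpos n; positivity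
    have h3 : 0 ≤ 1 / 2 * ‖T (u n) - e‖ ^ 2 := by positivity
    simp only [hE, regEnergy]; linarith
  have hEbdd : BddBelow (range E) := by
    refine ⟨∫ x in (Ω : Set (Rd d)), -C, ?_⟩
    rintro _ ⟨n, rfl⟩
    exact (integral_mono (integrable_const _) (hji n) fun x => hC _).trans (hjE n)
  have hElim := tendsto_atTop_ciInf hEanti hEbdd
  set I := ⨅ n, E n
  have hIle : ∀ n, I ≤ E n := fun n => ciInf_le hEbdd n
  set w : ℕ → H10 Ω := fun n => R (L2ToHm1 Ω (u n) - f) with hw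
  have hgrad : ∀ n, H10.grad (w n) = T (u n) - e := fun n => by
    have : w n = R (L2ToHm1 Ω (u n)) - R f := map_sub R _ _
    rw [this]; rfl
  -- The gradients of `w N` and `w n` differ by at most four times the energy drop in square norm,
  -- and the energies converge; Poincaré's inequality upgrades this to `H¹₀`.
  have hwcauchy : CauchySeq w := by
    rw [Metric.cauchySeq_iff']
    intro ε hε
    have hev : ∀ᶠ n in atTop, A * (4 * (E n - I)) < ε ^ 2 := by
      have : Tendsto (fun n => A * (4 * (E n - I))) atTop (𝓝 0) := by
        simpa using ((hElim.sub_const I).const_mul 4).const_mul A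
      exact this.eventually (gt_mem_nhds (by positivity))
    obtain ⟨N, hN⟩ := eventually_atTop.1 hev
    refine ⟨N, fun n hn => ?_⟩
    rw [dist_eq_norm, norm_sub_rev]
    refine lt_of_pow_lt_pow_left₀ 2 hε.le (lt_of_le_of_lt ?_ (hN N le_rfl))
    have h1 := norm_sq_sub_le_of_minimizer hconv hj (hδpos n).le (huK n) (humin n) (hmono hn)
    have h2 : H10.grad (w N - w n) = T (u N) - T (u n) := by
      have : H10.grad (w N - w n) = H10.grad (w N) - H10.grad (w n) := rfl
      rw [this, hgrad, hgrad, sub_sub_sub_cancel_right]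
    refine (hA _).trans (mul_le_mul_of_nonneg_left ?_ hA0.le)
    rw [h2]
    refine h1.trans ?_
    have h3 : regEnergy j T e (δ n) (u n) = E n := rfl
    linarith [hEle hn, hIle n]
  obtain ⟨w₀, hw₀⟩ := cauchySeq_tendsto_of_complete hwcauchy
  obtain ⟨ns, hns, hae⟩ := (tendstoInMeasure_of_tendsto_Lp
    ((H10.continuous_fn.tendsto w₀).comp hw₀)).exists_seq_tendsto_ae
  refine ⟨fun k => u (ns k), fun k => w (ns k), w₀, fun k => δ (ns k), E 0, fun n φ => ?_,
    hw₀.comp hns.tendsto_atTop, hae, fun n => (hδpos _).le, hδlim.comp hns.tendsto_atTop,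
    fun n => hji _, fun n => (hjE _).trans (hEanti (Nat.zero_le _)), fun s => ?_⟩
  · exact hR (L2ToHm1 Ω (u (ns n)) - f) φ
  -- The constant `s` is an admissible value only when `|s| ≤ n`, hence an inequality for large `n`
  -- only.
  · obtain ⟨k, hk⟩ := exists_nat_ge |s|
    have hev : ∀ᶠ n in atTop, ∀ᵐ x ∂(vol Ω),
        j (u n x) ≤ j s + (δ n * u n x + H10.fn (w n) x) * (s - u n x) := by
      filter_upwards [eventually_ge_atTop k] with n hn
      have hs : |s| ≤ (n : ℝ) := hk.trans (Nat.cast_le.2 hn)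
      -- Symmetry of the Dirichlet problem: testing the equation for `(-Δ)⁻¹h` with `w n` identifies
      -- the adjoint of `T` applied to `T (u n) - e` as the function `w n`.
      have hadj : ∀ h, ⟪T (u n) - e, T h⟫ = ⟪H10.fn (w n), h⟫ := fun h => by
        rw [← hgrad]
        have h1 := hR (L2ToHm1 Ω h) (w n)
        rw [L2ToHm1_apply, dirichlet_eq_inner] at h1
        rw [real_inner_comm, real_inner_comm h]
        exact h1
      filter_upwards [pointwise_inequality_of_minimizer hconv hj (huK n) (humin n) hadj hs] with x hx
      linarith
    exact hns.tendsto_atTop.eventually hev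

/-- Solvability of the Euler-Lagrange system. -/
theorem exists_euler_lagrange [NeZero d] (hΩ : Bornology.IsBounded (Ω : Set (Rd d)))
    (f : Hm1 Ω) {j : ℝ → ℝ} (hconv : ConvexOn ℝ univ j) (hj : Continuous j)
    (hsuper : Tendsto (fun r : ℝ => j r / |r|) (cocompact ℝ) atTop)
    {C : ℝ} (hC0 : 0 ≤ C) (hC : ∀ r, -C ≤ j r) :
    ∃ (u : Lp ℝ 1 (vol Ω)) (w : H10 Ω), IsDiff u f (dirichletForm w) ∧
      ∀ᵐ x ∂(vol Ω), ∀ s, j (u x) ≤ j s + H10.fn w x * (s - u x) := by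
  have := isFiniteMeasure_vol hΩ
  obtain ⟨u, w, w₀, δ, B, hdir, hw, hae, hδ0, hδ, hji, hjB, hineq⟩ :=
    exists_approximate_solutions hΩ f hconv hj hC
  have hui : ∀ n, Integrable (u n) (vol Ω) := fun n =>
    (Lp.memLp (u n)).integrable (by norm_num)
  have hUI := fun ε (hε : ε > 0) => exists_integral_abs_sub_truncate_le hsuper hC0 hC hji hjB hε
  -- A nonprincipal ultrafilter replaces the extraction of a weakly convergent subsequence; being
  -- finer than `atTop`, it keeps all the other limits.
  obtain ⟨v, hv⟩ := exists_weak_L1_limit (hyperfilter ℕ) hui hUI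
  obtain ⟨B', hB'⟩ := exists_integral_abs_le hui hUI
  have hU : ((hyperfilter ℕ : Ultrafilter ℕ) : Filter ℕ) ≤ atTop := by
    rw [← Nat.cofinite_eq_atTop]; exact hyperfilter_le_cofinite
  refine ⟨v, w₀, fun φ => ?_, ?_⟩
  · obtain ⟨D, hD⟩ := φ.continuous.bounded_above_of_compact_support φ.hasCompactSupport
    have h1 := hv φ D φ.continuous.aestronglyMeasurable (Eventually.of_forall hD)
    have h2 : ∀ n, ∫ x in (Ω : Set (Rd d)), u n x * φ x
        = dirichlet (w n) (H10.ofTest φ) + f (H10.ofTest φ) := fun n => by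
      rw [hdir, sub_add_cancel, L2.inner_def]
      refine integral_congr_ae ?_
      filter_upwards [H10.fn_ofTest φ] with x hx
      rw [hx]; simp [mul_comm]
    simp only [h2] at h1
    have h3 : Tendsto (fun n => dirichlet (w n) (H10.ofTest φ) + f (H10.ofTest φ))
        (hyperfilter ℕ : Filter ℕ) (𝓝 (dirichlet w₀ (H10.ofTest φ) + f (H10.ofTest φ))) := by
      refine Tendsto.add_const _ ?_
      simp only [dirichlet_eq_inner]
      exact (((H10.continuous_grad.tendsto w₀).comp hw).inner tendsto_const_nhds).mono_left hU
    rw [tendsto_nhds_unique h1 h3, add_sub_cancel_right]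
    rfl
  · exact subgradient_of_weak_limit hconv hj hU hui (L1.integrable_coeFn v) hv hB'
      (fun n => Lp.stronglyMeasurable _) (Lp.stronglyMeasurable _) hae hδ0 hδ hineq

/-! ### Solutions of the Euler-Lagrange system are the unique minimisers -/

section EulerLagrange

variable {f : Hm1 Ω} {j : ℝ → ℝ} {u : Lp ℝ 1 (vol Ω)} {w : H10 Ω}

/-- The subgradient inequality at `s = 0`, with `j 0 = 0`, gives `-C ≤ j(u) ≤ -u w`. Thus `-u w` is
bounded below, `integrable_mul_fn` makes it integrable, and `j(u)` lies between integrable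
functions. -/
theorem integrable_comp_of_euler_lagrange (hΩ : Bornology.IsBounded (Ω : Set (Rd d)))
    (hj : Continuous j) (hj0 : j 0 = 0) {C : ℝ} (hC : ∀ r, -C ≤ j r)
    (hdiff : IsDiff u f (dirichletForm w))
    (hsub : ∀ᵐ x ∂(vol Ω), ∀ s, j (u x) ≤ j s + H10.fn w x * (s - u x)) :
    Integrable (fun x => j (u x)) (vol Ω) := by
  have := isFiniteMeasure_vol hΩ
  have hneg : H10.fn (-w) =ᵐ[vol Ω] fun x => - H10.fn w x := Lp.coeFn_neg (H10.fn w)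
  have hle : ∀ᵐ x ∂(vol Ω), j (u x) ≤ u x * H10.fn (-w) x := by
    filter_upwards [hsub, hneg] with x hx h
    have := hx 0
    rw [h]; linarith
  have hint := (integrable_mul_fn (L1.integrable_coeFn u) (G := dirichletForm w + f)
    (fun φ => by rw [_root_.add_apply, ← hdiff φ]; ring) (-w)
    (integrable_const C) (hle.mono fun x hx => (hC _).trans hx)).1
  refine Integrable.mono' (hint.abs.add (integrable_const |C|))
    (hj.comp_aestronglyMeasurable (Lp.aestronglyMeasurable u)) ?_
  filter_upwards [hle] with x hx
  rw [Real.norm_eq_abs, abs_le]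
  simp only [Pi.add_apply]
  have h1 := hC (u x)
  have h2 := le_abs_self C
  have h3 := le_abs_self (u x * H10.fn (-w) x)
  have h4 := abs_nonneg (u x * H10.fn (-w) x)
  have h5 := abs_nonneg C
  constructor <;> linarith

/-- The energy of a competitor exceeds that of a solution of the Euler-Lagrange system at least by
half the square of the distance in `H⁻¹(Ω)`. -/
theorem energy_gap
    (hju : Integrable (fun x => j (u x)) (vol Ω))
    (hdiff : IsDiff u f (dirichletForm w))
    (hsub : ∀ᵐ x ∂(vol Ω), ∀ s, j (u x) ≤ j s + H10.fn w x * (s - u x))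
    {v : Lp ℝ 1 (vol Ω)} {z : H10 Ω} (hv : IsDiff v f (dirichletForm z))
    (hjv : Integrable (fun x => j (v x)) (vol Ω)) :
    (∫ x in (Ω : Set (Rd d)), j (u x)) + 1 / 2 * ‖H10.grad w‖ ^ 2
        + 1 / 2 * ‖H10.grad z - H10.grad w‖ ^ 2
      ≤ (∫ x in (Ω : Set (Rd d)), j (v x)) + 1 / 2 * ‖H10.grad z‖ ^ 2 := by
  have hu1 := L1.integrable_coeFn u
  have hv1 := L1.integrable_coeFn v
  have htest : ∀ (g : Lp ℝ 1 (vol Ω)) (φ : 𝓓(Ω, ℝ)),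
      Integrable (fun x => g x * φ x) (vol Ω) := fun g φ => by
    obtain ⟨D, hD⟩ := φ.continuous.bounded_above_of_compact_support φ.hasCompactSupport
    exact integrable_mul_of_ae_bound (L1.integrable_coeFn g) φ.continuous.aestronglyMeasurable
      (Eventually.of_forall hD)
  have hle : ∀ᵐ x ∂(vol Ω), -(j (v x) - j (u x)) ≤ (v x - u x) * H10.fn w x := by
    filter_upwards [hsub] with x hx
    linarith [hx (v x)]
  -- The subgradient inequality at `s = v x` is exactly the one-sided bound needed to pair `v - u`
  -- with `w`.
  obtain ⟨h1, h2⟩ := integrable_mul_fn (hv1.sub hu1) (G := dirichletForm z - dirichletForm w)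
    (fun φ => by
      simp only [Pi.sub_apply, sub_mul]
      rw [integral_sub (htest v φ) (htest u φ), _root_.sub_apply, ← hv φ, ← hdiff φ]
      ring) w (hjv.sub hju) hle
  have h3 : (∫ x in (Ω : Set (Rd d)), j (u x)) - (∫ x in (Ω : Set (Rd d)), j (v x))
      ≤ dirichletForm z w - dirichletForm w w := by
    rw [← _root_.sub_apply, ← h2, ← integral_sub hju hjv]
    refine integral_mono_ae (hju.sub hjv) h1 ?_
    filter_upwards [hle] with x hx
    simp only [Pi.sub_apply]
    linarith
  rw [dirichletForm_apply, dirichletForm_apply, dirichlet_eq_inner, dirichlet_eq_inner,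
    real_inner_self_eq_norm_sq] at h3
  -- Expanding the square leaves `½‖∇z‖² - ½‖∇w‖² - ½‖∇(z - w)‖² = ∫ ∇z ⬝ ∇w - ‖∇w‖²`, the right
  -- side of `h3`.
  rw [norm_sub_sq_real]
  linarith

theorem normSqHm1_dirichletForm [NeZero d] (hΩ : Bornology.IsBounded (Ω : Set (Rd d)))
    (z : H10 Ω) : normSqHm1 (dirichletForm z) = ‖H10.grad z‖ ^ 2 := by
  rw [normSqHm1, invNegLaplacian_eq hΩ (F := dirichletForm z) (w := z) fun φ => rfl,
    dirichletForm_apply, dirichlet_eq_inner, real_inner_self_eq_norm_sq]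

/-- Elements of `L¹(Ω)` which agree as distributions are equal. -/
theorem IsDiff.eq_of_eq {v : Lp ℝ 1 (vol Ω)} {F : Hm1 Ω} (hu : IsDiff u f F) (hv : IsDiff v f F) :
    u = v := by
  have hu1 := L1.integrable_coeFn u
  have hv1 := L1.integrable_coeFn v
  have hloc : LocallyIntegrableOn (fun x => u x - v x) (Ω : Set (Rd d)) volume :=
    IntegrableOn.locallyIntegrableOn (hu1.sub hv1)
  -- The fundamental lemma of the calculus of variations: `u - v` annihilates every test function.
  have h := Ω.isOpen.ae_eq_zero_of_integral_contDiff_smul_eq_zero hloc fun g hg hgc hgs => by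
    let φ : 𝓓(Ω, ℝ) := ⟨g, hg, hgc, hgs⟩
    have hφ : ∀ x, φ x = g x := fun x => rfl
    obtain ⟨D, hD⟩ := hg.continuous.bounded_above_of_compact_support hgc
    have htest : ∀ (g' : Lp ℝ 1 (vol Ω)), Integrable (fun x => g' x * g x) (vol Ω) := fun g' =>
      integrable_mul_of_ae_bound (L1.integrable_coeFn g') hg.continuous.aestronglyMeasurable
        (Eventually.of_forall hD)
    rw [← setIntegral_eq_integral_of_forall_compl_eq_zero (s := (Ω : Set (Rd d)))]
    · have h1 := (hu φ).trans (hv φ).symm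
      simp only [hφ] at h1
      simp only [smul_eq_mul, mul_comm (g _), sub_mul]
      rw [integral_sub (htest u) (htest v)]
      linarith
    · intro x hx
      rw [image_eq_zero_of_notMem_tsupport fun h => hx (hgs h), zero_smul]
  refine Lp.ext ?_
  filter_upwards [(ae_restrict_iff' Ω.isOpen.measurableSet).2 h] with x hx
  linarith

end EulerLagrange

end ImageRestoration

/-! ### Existence, uniqueness and the Euler-Lagrange equation -/

theorem theorem6p1 {d : ℕ} [NeZero d] (Ω : TopologicalSpace.Opens (EuclideanSpace ℝ (Fin d)))
    (hΩ : Bornology.IsBounded (Ω : Set (EuclideanSpace ℝ (Fin d))))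
    (f : Hm1 Ω) (j : ℝ → ℝ)
    (hconv : ConvexOn ℝ Set.univ j) (hlsc : LowerSemicontinuous j) (hj0 : j 0 = 0)
    (hsuper : Filter.Tendsto (fun r : ℝ => j r / |r|) (Filter.cocompact ℝ) Filter.atTop) :
    ∃ u : Lp ℝ 1 (vol Ω), IsSolution j f u ∧ (∀ v : Lp ℝ 1 (vol Ω), IsSolution j f v → v = u) ∧
      ∃ η : H10 Ω, (∀ᵐ x ∂(vol Ω), H10.fn η x ∈ subdifferential j (u x)) ∧
        ∀ φ : H10 Ω,
          (∫ x in (Ω : Set (EuclideanSpace ℝ (Fin d))), ⟪H10.grad η x, H10.grad φ x⟫)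
            + subHm1 u f φ = 0 := by
  have hj : Continuous j := continuousOn_univ.1 (hconv.continuousOn isOpen_univ)
  obtain ⟨C, hC0, hC⟩ := exists_neg_le_of_superlinear hj hsuper
  obtain ⟨u, w, hdiff, hsub⟩ := exists_euler_lagrange hΩ f hconv hj hsuper hC0 hC
  obtain ⟨R, hR⟩ := exists_dirichlet_solution_operator hΩ
  have hju := integrable_comp_of_euler_lagrange hΩ hj hj0 hC hdiff hsub
  -- Every element of `H⁻¹(Ω)` is `-Δz` for some `z`, so each competitor's energy can be written
  -- with `‖∇z‖²`.
  have hform : ∀ F : Hm1 Ω, dirichletForm (R F) = F := fun F => by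
    ext φ; exact hR F φ
  have henergy : ∀ {v : Lp ℝ 1 (vol Ω)} {z : H10 Ω}, IsDiff v f (dirichletForm z) →
      Integrable (fun x => j (v x)) (vol Ω) →
      energy j f v
        = (((∫ x in (Ω : Set (Rd d)), j (v x)) + 1 / 2 * ‖H10.grad z‖ ^ 2 : ℝ) : EReal) := by
    intro v z hv hjv
    have h1 : subHm1 v f = dirichletForm z := (isDiff_subHm1 ⟨_, hv⟩).unique hv
    rw [energy, if_pos hjv, h1, normSqHm1_dirichletForm hΩ]
  have hadm : u ∈ admissible f := ⟨_, hdiff⟩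
  have hcomp : ∀ v ∈ admissible f, ∃ z : H10 Ω, IsDiff v f (dirichletForm z) := by
    rintro v ⟨F, hF⟩
    exact ⟨R F, by rwa [hform]⟩
  refine ⟨u, ⟨hadm, fun v hv => ?_⟩, fun v hv => ?_, -w, ?_, fun φ => ?_⟩
  · obtain ⟨z, hz⟩ := hcomp v hv
    show energy j f u ≤ energy j f v
    by_cases hjv : Integrable (fun x => j (v x)) (vol Ω)
    · rw [henergy hdiff hju, henergy hz hjv, EReal.coe_le_coe_iff]
      have := energy_gap hju hdiff hsub hz hjv
      have h0 : 0 ≤ 1 / 2 * ‖H10.grad z - H10.grad w‖ ^ 2 := by positivity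
      linarith
    · rw [energy, energy, if_neg hjv]
      exact le_top
  · obtain ⟨z, hz⟩ := hcomp v hv.1
    have hle : energy j f v ≤ energy j f u := hv.2 hadm
    rw [henergy hdiff hju] at hle
    have hjv : Integrable (fun x => j (v x)) (vol Ω) := by
      by_contra hjv
      rw [energy, if_neg hjv] at hle
      exact absurd (top_le_iff.1 hle) (EReal.coe_ne_top _)
    rw [henergy hz hjv, EReal.coe_le_coe_iff] at hle
    have hgap := energy_gap hju hdiff hsub hz hjv
    -- Equal energies leave no room for the quadratic gap, so `v - f` and `u - f` coincide in
    -- `H⁻¹(Ω)`.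
    have hgrad : H10.grad z = H10.grad w := by
      have h1 : ‖H10.grad z - H10.grad w‖ ^ 2 ≤ 0 := by linarith
      rw [← sub_eq_zero, ← norm_eq_zero]
      exact pow_eq_zero_iff two_ne_zero |>.1 (le_antisymm h1 (sq_nonneg _))
    have hzw : dirichletForm z = dirichletForm w := by
      ext φ
      rw [dirichletForm_apply, dirichletForm_apply, dirichlet_eq_inner, dirichlet_eq_inner, hgrad]
    exact IsDiff.eq_of_eq hz (hzw ▸ hdiff)
  · have hneg : H10.fn (-w) =ᵐ[vol Ω] fun x => - H10.fn w x := Lp.coeFn_neg (H10.fn w)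
    filter_upwards [hsub, hneg] with x hx h s
    rw [h]
    linarith [hx s]
  · have h1 : subHm1 u f = dirichletForm w := (isDiff_subHm1 hadm).unique hdiff
    have h2 : (∫ x in (Ω : Set (Rd d)), ⟪H10.grad (-w) x, H10.grad φ x⟫)
        = - dirichletForm w φ := by
      rw [← L2.inner_def]
      exact inner_neg_left (H10.grad w) (H10.grad φ)
    rw [h1]
    exact (congrArg (· + dirichletForm w φ) h2).trans (neg_add_cancel _)
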